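/- **The network.** Let $G$ be a connected graph with node set $V$ and uniformly bounded degrees; write $u\sim v$ for neighbours and $\mathrm{dist}$ for the graph distance. Let $K$ be a finite set of customer classes. A customer carries a class $\varkappa\in K$ and a destination $D\in V$. The comb is $M=\bigsqcup_w \mathbb R_+^{|w|}$, over finite words $w$ in the alphabet $K\times V$: a point $q\in M$ lists the customers of a queue in order of arrival and the amounts of service $\tau_i\ge 0$ they have received. All nodes use the same comb, $M(v)=M$. The following data are given: * exchange rates $\beta_{uv}=\beta_{vu}\ge 0$ for $u\sim v$, uniformly bounded; * arrival rates $\lambda(\varkappa,v,d)\ge 0$ to $v$ of customers of class $\varkappa$ with destination $d$, with $\sup_v\sum_{\varkappa,d}\lambda(\varkappa,v,d)<\infty$; * a class change map $\mathcal T(\varkappa;v,u)\in K$; * service time distribution functions $\mathcal F_{\varkappa,v}<1$ on $[0,\infty)$, differentiable there, with hazard rates $\mathcal F'_{\varkappa,v}/(1-\mathcal F_{\varkappa,v})$ uniformly bounded; * at every node $v$ a service discipline, choosing in each nonempty queue the customer $C(q)$ in service as a function of the sequence of classes and of distances from $v$ to the destinations. For $q$ at $v$ let $\sigma_f(q)=\mathcal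 F'_{\varkappa(C(q)),v}(\tau)/(1-\mathcal F_{\varkappa(C(q)),v}(\tau))$, where $\tau$ is the service received by $C(q)$, and $\sigma_f(\varnothing)=0$. Let $\psi^v(q)=q\ominus C(q)$, $\psi^v(\varnothing)=\varnothing$. Let $q\oplus(\varkappa,d)$ be $q$ with a new last customer of class $\varkappa$, destination $d$ and $\tau=0$. If $\mathrm{dist}(v,d)>1$, let $e_{v,d}$ be the uniform distribution on the neighbours $u$ of $v$ with $\mathrm{dist}(u,d)=\mathrm{dist}(v,d)-1$; if $\mathrm{dist}(v,d)\le1$, put $e_{v,d}=0$. Let $\psi^v_{nn}$ be $\psi^v$ on nonempty $q$ with $\mathrm{dist}(v,D(C(q)))\le 1$ and the identity elsewhere. For $u\sim v$ let $\zeta_{vu}(q_v,q_u)=(q_v\ominus C(q_v),\,q_u\oplus(\mathcal T(\varkappa(C(q_v));v,u),D(C(q_v))))$, unless $q_v=\varnothing$ or $D(C(q_v))=u$, when $\zeta_{vu}$ is the identity. **States and differentials.** A state is a product probability measure $\mu=\prod_v\mu_v$ on $\prod_v M(v)$. A tangent vector is a family $h=(h_v)$ of signed measures on $M$ with $h_v(M)=0$,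 bounded uniformly in $v$. Let $\|\cdot\|_1$ be the norm on signed measures on $M$ dual to $\|f\|_{\infty}+\|f'\|_{\infty}$ on the space $\mathcal C_1$ of functions that are $C^1$ on each (closed) orthant. A function $F$ of the state is (quasi-local and) Fréchet differentiable at $\mu$, with differential $F'_\mu$, if for some summable weights $a_v\ge0$ the linear functional $F'_\mu$ on tangent vectors is bounded with respect to $\|h\|=\sum_v a_v\|h_v\|_1$, and $F(\nu)=F(\mu)+F'_\mu(\nu-\mu)+o(\|\nu-\mu\|)$ for states $\nu$ with $\|\nu-\mu\|\to0$. The time shift $S^{sh}_t$ transports each $\mu_v$ by the motion that raises $\tau(C(q_v))$ at unit speed. Its generator is $\hat\sigma(F)(\mu)=\frac{d}{dt}\big|_{t=0^+}F(S^{sh}_t\mu)$; write $d/dr$ for the derivative along this motion. **The limiting generator** is $$\Omega(F)(\mu)=\hat\sigma(F)(\mu)+\sum_v\sum_{u\sim v}F'_\mu\big(e_{v,D(C(\cdot))}(u)\,\sigma_f\times(\zeta_{vu}(\mu)-\mu)\big)+\sum_{v,d,\varkappa}\lambda(\varkappa,v,d)\,F'_\mu(\chi_{v,d;\varkappa}(\mu)-\mu)$$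 $$+\sum_vF'_\mu\big(\sigma_f\times(\psi^v_{nn}(\mu)-\mu)\big)+\sum_v\sum_{u\sim v}\beta_{uv}F'_\mu(T_{uv}\mu-\mu).$$ Here $\chi_{v,d;\varkappa}$ is $q\mapsto q\oplus(\varkappa,d)$ acting on $\mu_v$, and $T_{uv}$ replaces $\mu_v$ by $\mu_u$. For a map $\phi$ and an intensity $\rho$, $\rho\times(\phi(\mu)-\mu)$ is $\phi_*(\rho\mu)-\rho\mu$, that is, mass is weighted by the intensity at the point it is taken from. For $\zeta_{vu}$ this is a signed measure on $M(v)\times M(u)$, acting on the components $v$ and $u$ through its marginals. **The evolution equation** is $\dot\mu_v=\mathcal A_v+\mathcal B_v+\mathcal C_v+\mathcal D_v+\mathcal E_v$. The transport term is $\mathcal A_v=-\frac{d}{dr}\mu_v$, in the sense $\int f\,d\mathcal A_v=\int\frac{df}{dr}\,d\mu_v$ for $f\in\mathcal C_1$. For Borel $A\subseteq M$, $$\mathcal B_v(A)=\sum_{c\in K\times V}\big(\sigma^\mu_{tr}(v,c)+\lambda(v,c)\big)\,\mu_v\{q:q\oplus c\in A\},\qquad \mathcal C_v(A)=-\mu_v(A)\sum_{c}\big(\sigma^\mu_{tr}(v,c)+\lambda(v,c)\big),$$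 $$\mathcal D_v(A)=\int_{\{q:\,q\ominus C(q)\in A\}}\sigma_f\,d\mu_v-\int_A\sigma_f\,d\mu_v,\qquad \mathcal E_v(A)=\sum_{u\sim v}\beta_{vu}\big(\mu_u(A)-\mu_v(A)\big).$$ Here $\lambda(v,(\varkappa,d))=\lambda(\varkappa,v,d)$, and the transit rate is $$\sigma^\mu_{tr}(v,(\varkappa,d))=\sum_{u\sim v}\int e_{u,D(C(q))}(v)\,\sigma_f(q)\,\mathbf 1\{\mathcal T(\varkappa(C(q));u,v)=\varkappa,\ D(C(q))=d\}\,d\mu_u(q).$$ **Proposition.** Let $F$ be Fréchet differentiable at $\mu$. Then the four series in $\Omega(F)(\mu)$ converge absolutely, $g(\mu)=(\mathcal B_v+\mathcal C_v+\mathcal D_v+\mathcal E_v)_v$ is a tangent vector (a uniformly bounded family of signed measures of zero total mass), and $$\Omega(F)(\mu)=\hat\sigma(F)(\mu)+F'_\mu(g(\mu)).$$ Moreover $\hat\sigma$ accounts for the transport term: if $\mathcal A=(\mathcal A_v)_v$ is a uniformly bounded family of signed measures of zero total mass, then $\hat\sigma(F)(\mu)$ exists and equals $F'_\mu(\mathcal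 A)$, so that $\Omega(F)(\mu)=F'_\mu(\mathcal A+g(\mu))$, with the full right-hand side of the evolution equation. -/

import Mathlib

open MeasureTheory Set Filter Topology
open scoped NNReal

noncomputable section

/-! ## Queue states -/

/-- The comb `M(v)`: the disjoint union, over all finite words `w` of customer labels (class,
destination), of the positive orthants `ℝ₊^{|w|}`. The letters of `w` are listed in the order of
arrival and the `i`-th coordinate is the service already received by the `i`-th customer. -/
abbrev Queue (K V : Type*) := Σ w : List (K × V), (Fin w.length → ℝ≥0)

namespace Queue

variable {K V : Type*}

/-- The service received by the customer at position `j` (zero if there is none). -/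
def attained (q : Queue K V) (j : ℕ) : ℝ≥0 :=
  if h : j < q.1.length then q.2 ⟨j, h⟩ else 0

/-- `q ⊕ c`: a new customer with label `c`, without any service received, joins the queue at the
last position. -/
def arrive (c : K × V) (q : Queue K V) : Queue K V :=
  ⟨q.1 ++ [c], fun j => q.attained j⟩

/-- The customer at position `i` is removed from the queue. -/
def remove (i : ℕ) (q : Queue K V) : Queue K V :=
  ⟨q.1.eraseIdx i, fun j => q.attained (if (j : ℕ) < i then j else j + 1)⟩

/-- The customer at position `i` receives `t` units of service. -/
def serve (i : ℕ) (t : ℝ≥0) (q : Queue K V) : Queue K V :=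
  ⟨q.1, fun j => if (j : ℕ) = i then q.2 j + t else q.2 j⟩

theorem measurable_of_fibers {α : Type*} [MeasurableSpace α] {f : Queue K V → α}
    (h : ∀ w, Measurable fun x => f ⟨w, x⟩) : Measurable f := by
  intro A hA
  have : ∀ w, MeasurableSet[MeasurableSpace.map (Sigma.mk w) MeasurableSpace.pi] (f ⁻¹' A) :=
    fun w => h w hA
  exact MeasurableSpace.measurableSet_iInf.2 this

theorem measurable_mk (w : List (K × V)) :
    Measurable fun x : Fin w.length → ℝ≥0 => (⟨w, x⟩ : Queue K V) := by
  intro A hA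
  exact MeasurableSpace.measurableSet_iInf.1 hA w

theorem measurable_attained (w : List (K × V)) (j : ℕ) :
    Measurable fun x : Fin w.length → ℝ≥0 => attained (⟨w, x⟩ : Queue K V) j := by
  unfold attained
  by_cases h : j < w.length
  · simpa [h] using measurable_pi_apply (X := fun _ : Fin w.length => ℝ≥0) ⟨j, h⟩
  · simp [h]

theorem measurable_arrive (c : K × V) : Measurable (arrive c : Queue K V → Queue K V) :=
  measurable_of_fibers fun w => (measurable_mk (w ++ [c])).comp
    (measurable_pi_lambda _ fun j => measurable_attained w j)

end Queue

/-! ## The network -/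

/-- The data of a queueing network with jumping servers, on a connected graph with uniformly
bounded degrees and with a finite set `K` of customer classes. -/
structure JumpingNetwork (K V : Type*) where
  graph : SimpleGraph V
  connected : graph.Connected
  finite_neighborSet : ∀ v, (graph.neighborSet v).Finite
  bounded_degree : ∃ d : ℕ, ∀ v, (graph.neighborSet v).ncard ≤ d
  /-- The rate `β v v'` at which the servers at the neighbouring nodes `v`, `v'` are exchanged. -/
  exchangeRate : V → V → ℝ
  exchangeRate_nonneg : ∀ v v', graph.Adj v v' → 0 ≤ exchangeRate v v'
  exchangeRate_symm : ∀ v v', graph.Adj v v' → exchangeRate v v' = exchangeRate v' v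
  exchangeRate_bounded : ∃ b : ℝ, ∀ v v', graph.Adj v v' → |exchangeRate v v'| < b
  /-- The rate `lam κ v v'` of external arrivals to `v` of customers of class `κ` with
  destination `v'`. -/
  lam : K → V → V → ℝ
  lam_nonneg : ∀ κ v v', 0 ≤ lam κ v v'
  lam_summable : ∀ v, Summable fun c : K × V => lam c.1 v c.2
  lam_bounded : ∃ b : ℝ, ∀ v, ∑' c : K × V, lam c.1 v c.2 < b
  /-- `newClass κ v u` is the class obtained by a customer of class `κ` that completes its service
  at `v` and goes to `u`. -/
  newClass : K → V → V → K
  /-- The law of the service time of a customer of class `κ` at the node `v`. -/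
  service : K → V → ProbabilityMeasure ℝ
  service_nonneg : ∀ κ v, service κ v (Iio 0) = 0
  service_differentiable : ∀ κ v,
    DifferentiableOn ℝ (ProbabilityTheory.cdf (service κ v : Measure ℝ)) (Ici 0)
  service_lt_one : ∀ κ v τ, ProbabilityTheory.cdf (service κ v : Measure ℝ) τ < 1
  service_bounded : ∃ b : ℝ, ∀ κ v, ∀ τ ∈ Ici (0 : ℝ),
    derivWithin (ProbabilityTheory.cdf (service κ v : Measure ℝ)) (Ici 0) τ /
      (1 - ProbabilityTheory.cdf (service κ v : Measure ℝ) τ) ≤ b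
  /-- The service discipline at `v`: the position of the customer in service, as a function of the
  sequence of pairs (class, distance from `v` to the destination). -/
  discipline : V → List (K × ℕ) → ℕ
  /-- The discipline is conservative: a nonempty queue is being served. -/
  discipline_lt : ∀ v l, l ≠ [] → discipline v l < l.length

/-- A state `μ = ∏ μ_v` of the limiting network, a product probability measure on `∏ M(v)`, given
by its factors. -/
abbrev NetState (K V : Type*) := V → ProbabilityMeasure (Queue K V)

namespace JumpingNetwork

variable {K V : Type*} (net : JumpingNetwork K V)

/-- The nearest neighbours of `v`. -/
def nbrs (v : V) : Finset V := (net.finite_neighborSet v).toFinset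

/-- The position `i*(q)` of the customer in service when the queue `q` is at `v`. -/
def servedIdx (v : V) (q : Queue K V) : ℕ :=
  net.discipline v (q.1.map fun c => (c.1, net.graph.dist v c.2))

/-- The label (class, destination) of the customer `C(q)` in service when the queue `q` is at `v`;
`none` if the queue is empty. -/
def served (v : V) (q : Queue K V) : Option (K × V) := q.1[net.servedIdx v q]?

/-- `ψ^v`, that is `q ↦ q ⊖ C(q)`: the customer in service is removed. -/
def depart (v : V) (q : Queue K V) : Queue K V := q.remove (net.servedIdx v q)

/-- The time shift on `M(v)`: the motion along the field `r` during the time `t`. -/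
def shift (v : V) (t : ℝ≥0) (q : Queue K V) : Queue K V := q.serve (net.servedIdx v q) t

/-- The hazard rate `𝓕'(τ) / (1 - 𝓕(τ))` of the service time distribution function `𝓕`
(with the right derivative at `τ = 0`). -/
def hazard (κ : K) (v : V) (τ : ℝ) : ℝ :=
  derivWithin (ProbabilityTheory.cdf (net.service κ v : Measure ℝ)) (Ici 0) τ /
    (1 - ProbabilityTheory.cdf (net.service κ v : Measure ℝ) τ)

/-- The rate `σ_f(q, q ⊖ C(q))` of service completion in the queue `q` at `v`. -/
def serviceRate (v : V) (q : Queue K V) : ℝ :=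
  match net.served v q with
  | none => 0
  | some c => net.hazard c.1 v (q.attained (net.servedIdx v q))

open Classical in
/-- The number `E(v, d)` of neighbours of `v` which are closer to `d` than `v`. -/
def closerCount (v d : V) : ℕ :=
  ((net.nbrs v).filter fun u => net.graph.dist v d = net.graph.dist u d + 1).card

open Classical in
/-- The routing probability `e_{v,d}(u)`; it vanishes when `dist v d ≤ 1`, in which case a customer
with destination `d` served at `v` leaves the network. -/
def routing (v d u : V) : ℝ :=
  if 1 < net.graph.dist v d ∧ net.graph.Adj v u ∧ net.graph.dist v d = net.graph.dist u d + 1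
  then 1 / (net.closerCount v d : ℝ) else 0

/-- The rate `e_{v,D(C(q))}(u) σ_f(q, q ⊖ C(q))` at which the customer served in the queue `q` at
`v` completes its service and goes to `u`. -/
def jumpRate (v u : V) (q : Queue K V) : ℝ :=
  match net.served v q with
  | none => 0
  | some c => net.routing v c.2 u * net.serviceRate v q

open Classical in
/-- `ζ_{vu}`: the customer in service at `v` goes to the end of the queue at `u`, unless `u` is its
destination. -/
def zeta (v u : V) (p : Queue K V × Queue K V) : Queue K V × Queue K V :=
  match net.served v p.1 with
  | none => p
  | some c =>
    if c.2 = u then p else (net.depart v p.1, p.2.arrive (net.newClass c.1 v u, c.2))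

open Classical in
/-- `ψ_nn^v`: the customer in service at `v` leaves the network if its destination is at distance
at most one. -/
def psiNN (v : V) (q : Queue K V) : Queue K V :=
  match net.served v q with
  | none => q
  | some c => if net.graph.dist v c.2 ≤ 1 then net.depart v q else q

theorem measurable_depart (v : V) : Measurable (net.depart v) :=
  Queue.measurable_of_fibers fun w =>
    (Queue.measurable_mk (w.eraseIdx (net.servedIdx v (⟨w, 0⟩ : Queue K V)))).comp
      (measurable_pi_lambda _ fun j => Queue.measurable_attained w
        (if (j : ℕ) < net.servedIdx v (⟨w, 0⟩ : Queue K V) then j else j + 1))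

theorem measurable_shift (v : V) (t : ℝ≥0) : Measurable (net.shift v t) := by
  refine Queue.measurable_of_fibers fun w => (Queue.measurable_mk w).comp
    (measurable_pi_lambda _ fun j => ?_)
  have hj := measurable_pi_apply (X := fun _ : Fin w.length => ℝ≥0) j
  by_cases h : (j : ℕ) = net.servedIdx v (⟨w, 0⟩ : Queue K V)
  · have h' : ∀ x, (j : ℕ) = net.servedIdx v (⟨w, x⟩ : Queue K V) := fun _ => h
    simpa [← h'] using hj.add_const t
  · have h' : ∀ x, ¬ (j : ℕ) = net.servedIdx v (⟨w, x⟩ : Queue K V) := fun _ => h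
    simpa [h'] using hj

theorem measurable_psiNN (v : V) : Measurable (net.psiNN v) := by
  refine Queue.measurable_of_fibers fun w => ?_
  have hs : ∀ x, net.served v (⟨w, x⟩ : Queue K V) = net.served v (⟨w, 0⟩ : Queue K V) :=
    fun _ => rfl
  simp only [psiNN, hs]
  cases net.served v (⟨w, 0⟩ : Queue K V) with
  | none => exact Queue.measurable_mk w
  | some c =>
    dsimp only
    split_ifs
    · exact (net.measurable_depart v).comp (Queue.measurable_mk w)
    · exact Queue.measurable_mk w

theorem countable_nodes (net : JumpingNetwork K V) : Countable V := by
  obtain ⟨v⟩ := net.connected.nonempty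
  have hfin : ∀ n : ℕ, {u | net.graph.dist v u ≤ n}.Finite := by
    intro n
    induction n with
    | zero =>
      refine (finite_singleton v).subset fun u hu => ?_
      have h0 : net.graph.dist v u = 0 := Nat.le_zero.1 hu
      exact ((net.connected.preconnected v u).dist_eq_zero_iff.1 h0).symm
    | succ n ih =>
      refine (ih.union (ih.biUnion fun w _ => net.finite_neighborSet w)).subset fun u hu => ?_
      obtain ⟨p, hp⟩ := (net.connected.preconnected v u).exists_walk_length_eq_dist
      rcases Nat.lt_or_ge (net.graph.dist v u) (n + 1) with h | h
      · exact Or.inl (Nat.lt_succ_iff.1 h)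
      · have hlen : p.reverse.length = n + 1 := by
          rw [SimpleGraph.Walk.length_reverse, hp]; exact le_antisymm hu h
        cases hq : p.reverse with
        | nil => rw [hq] at hlen; simp at hlen
        | @cons _ w _ hadj r =>
          rw [hq] at hlen
          refine Or.inr (mem_biUnion (x := w) ?_ hadj.symm)
          have hr : r.reverse.length = n := by simpa using hlen
          exact (SimpleGraph.dist_le r.reverse).trans hr.le
  refine (countable_univ_iff (α := V)).1 ((countable_iUnion fun n => (hfin n).countable).mono ?_)
  exact fun u _ => mem_iUnion.2 ⟨net.graph.dist v u, le_refl (net.graph.dist v u)⟩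

theorem measurable_zeta [Countable K] (v u : V) : Measurable (net.zeta v u) := by
  classical
  have := net.countable_nodes
  let Z : Option (K × V) → Queue K V × Queue K V → Queue K V × Queue K V := fun o p =>
    match o with
    | none => p
    | some c =>
      if c.2 = u then p else (net.depart v p.1, p.2.arrive (net.newClass c.1 v u, c.2))
  have hZ : ∀ o, Measurable (Z o) := by
    rintro (_ | c)
    · exact measurable_id
    · by_cases h : c.2 = u
      · simpa [Z, h] using measurable_id'
      · simpa [Z, h] using ((net.measurable_depart v).comp measurable_fst).prodMk
          ((Queue.measurable_arrive _).comp measurable_snd)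
  have hserved : ∀ o, MeasurableSet {p : Queue K V × Queue K V | net.served v p.1 = o} := by
    intro o
    have : MeasurableSet {q : Queue K V | net.served v q = o} := by
      refine MeasurableSpace.measurableSet_iInf.2 fun w => ?_
      change MeasurableSet {_x : Fin w.length → ℝ≥0 | net.served v (⟨w, 0⟩ : Queue K V) = o}
      exact MeasurableSet.const _
    exact measurable_fst this
  intro A hA
  have : net.zeta v u ⁻¹' A = ⋃ o, {p | net.served v p.1 = o} ∩ Z o ⁻¹' A := by
    ext p
    simp only [mem_preimage, mem_iUnion, mem_inter_iff, mem_ofPred_eq, exists_eq_left']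
    rfl
  rw [this]
  exact MeasurableSet.iUnion fun o => (hserved o).inter (hZ o hA)

end JumpingNetwork

/-! ## Tangent vectors, the norm `‖·‖₁` and Fréchet differentials -/

section Tangent

variable {K V : Type*}

/-- Tangent vectors to the manifold of product states: families `h = (h_v)` of signed measures on
the combs with zero total mass, bounded uniformly in `v`. -/
def tangentSpace (K V : Type*) : Submodule ℝ (V → SignedMeasure (Queue K V)) where
  carrier := {h | (∀ v, h v univ = 0) ∧ ∃ C : ℝ, ∀ v A, |h v A| ≤ C}
  zero_mem' := ⟨fun v => by simp, 0, fun v A => by simp⟩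
  add_mem' := by
    rintro h k ⟨h0, C, hC⟩ ⟨k0, D, hD⟩
    refine ⟨fun v => by simp [h0 v, k0 v], C + D, fun v A => ?_⟩
    exact (abs_add_le _ _).trans (add_le_add (hC v A) (hD v A))
  smul_mem' := by
    rintro c h ⟨h0, C, hC⟩
    refine ⟨fun v => by simp [h0 v], |c| * C, fun v A => ?_⟩
    simpa [abs_mul] using mul_le_mul_of_nonneg_left (hC v A) (abs_nonneg c)

theorem single_mem_tangentSpace [DecidableEq V] (v : V) (s : SignedMeasure (Queue K V))
    (hs : s univ = 0) : Pi.single v s ∈ tangentSpace K V := by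
  refine ⟨fun u => ?_, s.bound, fun u A => ?_⟩
  · rcases eq_or_ne u v with rfl | h
    · simpa using hs
    · simp [h]
  · rcases eq_or_ne u v with rfl | h
    · simpa using s.norm_apply_le_bound (s := A)
    · simp [h]

open Classical in
/-- The tangent vector whose only nonzero component is `s`, at the node `v`. -/
def tangentSingle (v : V) (s : SignedMeasure (Queue K V)) (hs : s univ = 0) :
    tangentSpace K V :=
  ⟨Pi.single v s, single_mem_tangentSpace v s hs⟩

/-- The tangent vector `ν - μ`. -/
def stateDiff (ν μ : NetState K V) : tangentSpace K V :=
  ⟨fun v => (ν v : Measure (Queue K V)).toSignedMeasure -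
      (μ v : Measure (Queue K V)).toSignedMeasure, by
    refine ⟨fun v => by simp, 2, fun v A => ?_⟩
    refine (abs_sub _ _).trans ?_
    have key : ∀ m : ProbabilityMeasure (Queue K V),
        |(m : Measure (Queue K V)).toSignedMeasure A| ≤ 1 := by
      intro m
      by_cases hA : MeasurableSet A
      · rw [Measure.toSignedMeasure_apply_measurable hA, abs_of_nonneg measureReal_nonneg]
        exact measureReal_le_one
      · rw [VectorMeasure.not_measurable _ hA]; simp
    have h1 := key (ν v)
    have h2 := key (μ v)
    linarith⟩

/-- The closed positive orthant of the Euclidean space `ℝⁿ`. -/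
def orthant (n : ℕ) : Set (EuclideanSpace ℝ (Fin n)) := {x : EuclideanSpace ℝ (Fin n) | ∀ i, 0 ≤ x i}

/-- The function `f` on the orthant `ℝ₊^w` of the comb. -/
def onOrthant (f : Queue K V → ℝ) (w : List (K × V)) (x : EuclideanSpace ℝ (Fin w.length)) : ℝ :=
  f ⟨w, fun i => (x i).toNNReal⟩

/-- `f` belongs to the space `𝒞₁` of continuously differentiable functions on the comb (up to the
boundary of each orthant), with `‖f‖ ≤ b` and `‖f'‖ ≤ d` in the uniform norms. -/
structure IsC1 (f : Queue K V → ℝ) (b d : ℝ) : Prop where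
  contDiffOn : ∀ w : List (K × V), ContDiffOn ℝ 1 (onOrthant f w) (orthant w.length)
  bound : ∀ q, |f q| ≤ b
  deriv_bound : ∀ w : List (K × V), ∀ x ∈ orthant w.length,
    ‖fderivWithin ℝ (onOrthant f w) (orthant w.length) x‖ ≤ d

/-- The norm `‖h‖₁` of the dual space of `𝒞₁`, which carries the norm `‖f‖ + ‖f'‖`. -/
def norm1 (h : SignedMeasure (Queue K V)) : ℝ :=
  sSup {r | ∃ f b d, IsC1 f b d ∧ b + d ≤ 1 ∧ r = |∫ᵛ q, f q ∂<•h|}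

/-- The norm `∑_v a_v ‖h_v‖₁`; the weights `a` quantify the dependence on far-away nodes. -/
def weightedNorm (a : V → ℝ) (h : tangentSpace K V) : ℝ :=
  ∑' v, a v * norm1 (h.1 v)

/-- `L` is the Fréchet differential at `μ` of the (quasi-)local function `F` of the state, in the
norm `∑_v a_v ‖h_v‖₁` with summable weights `a`. For a local function, `a` has finite support. -/
structure HasFrechetDifferentialAt (a : V → ℝ) (F : NetState K V → ℝ) (μ : NetState K V)
    (L : tangentSpace K V →ₗ[ℝ] ℝ) : Prop where
  nonneg : ∀ v, 0 ≤ a v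
  summable : Summable a
  continuous : ∃ C : ℝ, ∀ h, |L h| ≤ C * weightedNorm a h
  isLittleO : ∀ ε > 0, ∃ δ > 0, ∀ ν : NetState K V, weightedNorm a (stateDiff ν μ) < δ →
    |F ν - F μ - L (stateDiff ν μ)| ≤ ε * weightedNorm a (stateDiff ν μ)

end Tangent

namespace JumpingNetwork

variable {K V : Type*} (net : JumpingNetwork K V)

/-! ## The limiting generator -/

/-- The time-shift semigroup on states: each `μ_v` is transported along the field `r`. -/
def shiftState (t : ℝ≥0) (μ : NetState K V) : NetState K V :=
  fun v => (μ v).map (net.measurable_shift v t).aemeasurable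

/-- The generator `σ̂` of the time-shift semigroup. -/
def timeShiftGenerator (F : NetState K V → ℝ) (μ : NetState K V) : ℝ :=
  derivWithin (fun t : ℝ => F (net.shiftState t.toNNReal μ)) (Ici 0) 0

/-- The signed measure on `M(v) × M(u)` which is `ζ_{vu}(Δ) - Δ` with the intensity
`e_{v,D(C(·))}(u) σ_f`: the mass carried along `ζ_{vu}` from each `(q_v, q_u)` is weighted with the
intensity at `(q_v, q_u)`. -/
def jumpFlux (v u : V) (μ : NetState K V) : SignedMeasure (Queue K V × Queue K V) :=
  let m := ((μ v : Measure (Queue K V)).prod (μ u : Measure (Queue K V))).withDensityᵥ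
    fun p => net.jumpRate v u p.1
  m.map (net.zeta v u) - m

/-- The tangent vector `e σ_f × (ζ_{vu}(Δ) - Δ)`: the signed measure `jumpFlux` acts on the
components `v` and `u` of the state through its two marginals. -/
def jumpTangent [Countable K] (v u : V) (μ : NetState K V) : tangentSpace K V :=
  have h0 : net.jumpFlux v u μ univ = 0 := by
    simp [jumpFlux, VectorMeasure.map_apply _ (net.measurable_zeta v u)]
  tangentSingle v ((net.jumpFlux v u μ).map Prod.fst)
      (by rw [VectorMeasure.map_apply _ measurable_fst .univ, preimage_univ, h0]) +
    tangentSingle u ((net.jumpFlux v u μ).map Prod.snd)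
      (by rw [VectorMeasure.map_apply _ measurable_snd .univ, preimage_univ, h0])

/-- The tangent vector `χ_{v,c}(Δ) - Δ`: a customer with label `c` arrives to `v`. -/
def arrivalTangent (v : V) (c : K × V) (μ : NetState K V) : tangentSpace K V :=
  tangentSingle v ((μ v : Measure (Queue K V)).toSignedMeasure.map (Queue.arrive c) -
      (μ v : Measure (Queue K V)).toSignedMeasure)
    (by simp [VectorMeasure.map_apply _ (Queue.measurable_arrive c)])

/-- The tangent vector `σ_f × (ψ_nn^v(Δ) - Δ)`, where the transported mass is weighted with the
intensity at the queue it is taken from. -/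
def exitTangent (v : V) (μ : NetState K V) : tangentSpace K V :=
  tangentSingle v
    (((μ v : Measure (Queue K V)).withDensityᵥ (net.serviceRate v)).map (net.psiNN v) -
      (μ v : Measure (Queue K V)).withDensityᵥ (net.serviceRate v))
    (by simp [VectorMeasure.map_apply _ (net.measurable_psiNN v)])

/-- The tangent vector `T_{uv}(Δ) - Δ`: the component `Δ_v` is replaced by `Δ_u`. -/
def exchangeTangent (u v : V) (μ : NetState K V) : tangentSpace K V :=
  tangentSingle v ((μ u : Measure (Queue K V)).toSignedMeasure -
      (μ v : Measure (Queue K V)).toSignedMeasure)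
    (by simp)

/-- The term of service completions at `v` followed by a jump to a neighbouring node. -/
def jumpTerm [Countable K] (L : tangentSpace K V →ₗ[ℝ] ℝ) (μ : NetState K V)
    (v : V) : ℝ :=
  ∑ u ∈ net.nbrs v, L (net.jumpTangent v u μ)

/-- The term of external arrivals to `v` of customers with label `c`. -/
def arrivalTerm (L : tangentSpace K V →ₗ[ℝ] ℝ) (μ : NetState K V) (p : V × (K × V)) : ℝ :=
  net.lam p.2.1 p.1 p.2.2 * L (arrivalTangent p.1 p.2 μ)

/-- The term of service completions at `v` followed by an exit from the network. -/
def exitTerm (L : tangentSpace K V →ₗ[ℝ] ℝ) (μ : NetState K V) (v : V) : ℝ :=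
  L (net.exitTangent v μ)

/-- The term of exchanges of the server at `v` with the servers at the neighbouring nodes. -/
def exchangeTerm (L : tangentSpace K V →ₗ[ℝ] ℝ) (μ : NetState K V) (v : V) : ℝ :=
  ∑ u ∈ net.nbrs v, net.exchangeRate u v * L (exchangeTangent u v μ)

/-- The value `Ω(F)(μ)` of the formal limiting generator; `L` is the Fréchet differential of `F`
at `μ`. -/
def limitGenerator [Countable K] (F : NetState K V → ℝ)
    (L : tangentSpace K V →ₗ[ℝ] ℝ) (μ : NetState K V) : ℝ :=
  net.timeShiftGenerator F μ + ∑' v, net.jumpTerm L μ v + ∑' p, net.arrivalTerm L μ p +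
    ∑' v, net.exitTerm L μ v + ∑' v, net.exchangeTerm L μ v

/-! ## The evolution equation of the non-linear Markov process -/

open Classical in
/-- The rate `σ_tr^μ` of arrival to the node `u` of transit customers with label `c`, in the state
`μ`. -/
def transitRate (μ : NetState K V) (u : V) (c : K × V) : ℝ :=
  ∑ v ∈ net.nbrs u, ∫ q,
    (match net.served v q with
      | none => 0
      | some c' => if net.newClass c'.1 v u = c.1 ∧ c'.2 = c.2 then net.jumpRate v u q else 0)
    ∂(μ v : Measure (Queue K V))

/-- The total rate `σ_tr + σ_e` of arrival to `v` of customers with label `c`. -/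
def totalArrivalRate (μ : NetState K V) (v : V) (c : K × V) : ℝ :=
  net.transitRate μ v c + net.lam c.1 v c.2

/-- `𝓑`: creation of a queue by the arrival of its last customer, who has received no service. -/
def termB (μ : NetState K V) (v : V) (A : Set (Queue K V)) : ℝ :=
  ∑' c, net.totalArrivalRate μ v c * (μ v : Measure (Queue K V)).real (Queue.arrive c ⁻¹' A)

/-- `𝓒`: loss of a queue by an arrival. -/
def termC (μ : NetState K V) (v : V) (A : Set (Queue K V)) : ℝ :=
  -((μ v : Measure (Queue K V)).real A * ∑' c, net.totalArrivalRate μ v c)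

/-- `𝓓`: creation and loss of a queue by a service completion. -/
def termD (μ : NetState K V) (v : V) (A : Set (Queue K V)) : ℝ :=
  (∫ q in net.depart v ⁻¹' A, net.serviceRate v q ∂(μ v : Measure (Queue K V))) -
    ∫ q in A, net.serviceRate v q ∂(μ v : Measure (Queue K V))

/-- `𝓔`: exchanges of servers. -/
def termE (μ : NetState K V) (v : V) (A : Set (Queue K V)) : ℝ :=
  ∑ u ∈ net.nbrs v, net.exchangeRate v u *
    ((μ u : Measure (Queue K V)).real A - (μ v : Measure (Queue K V)).real A)

/-- `g` is the part `𝓑 + 𝓒 + 𝓓 + 𝓔` of the right-hand side of the evolution equation in the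
state `μ`, as a family of signed measures. -/
def IsJumpPart (μ : NetState K V) (g : tangentSpace K V) : Prop :=
  ∀ v A, MeasurableSet A →
    g.1 v A = net.termB μ v A + net.termC μ v A + net.termD μ v A + net.termE μ v A

/-- The derivative of `f` along the field `r`, for queues at `v`. -/
def alongField (v : V) (f : Queue K V → ℝ) (q : Queue K V) : ℝ :=
  derivWithin (fun t : ℝ => f (net.shift v t.toNNReal q)) (Ici 0) 0

/-- `𝒶` is the transport term `𝓐_v = -dμ_v/dr` of the evolution equation in the state `μ`: the
derivative is understood in the sense of distributions, that is, `∫ f d𝓐_v = ∫ (df/dr) dμ_v` for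
all test functions `f`. -/
def IsTransportPart (μ : NetState K V) (𝒶 : tangentSpace K V) : Prop :=
  ∀ v f b d, IsC1 f b d →
    ∫ᵛ q, f q ∂<•(𝒶.1 v) = ∫ q, net.alongField v f q ∂(μ v : Measure (Queue K V))

end JumpingNetwork

end

/-! The identity has two independent halves: the four jump series sum to the differential `L`
applied to the jump part, and the derivative along the time shift is `L` applied to the transport
term.

For the jumps, every term of a series is `L` at a tangent vector. What has to be controlled is how
much mass all these vectors move at a single node, and this is bounded uniformly over the nodes
because rates and degrees are. The norm `norm1` is at most twice a setwise bound, so dominated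
convergence over the nodes, with the summable weights `a`, makes the partial sums converge in the
weighted norm. Hence `L` passes through the series (`exists_tangent_hasSum`), and the limit can be
computed set by set.

It remains to recognise the limit. The first marginal of a jump flux describes departures. Routing
probabilities sum to one at distance greater than one and vanish otherwise, exactly where exits take
over, so departures and exits together give `termD` (`jump_add_exit`, `sum_departures_add_exit`).
The second marginal is split by the label of the arriving customer; since the state is a product,
each piece is a transit rate times an increment of the target measure (`hasSum_transit`,
`jumpFlux_snd`). Adding external arrivals gives `termB` and `termC`; exchanges give `termE` by
symmetry of the rates. The identity case of `zeta` is harmless, because the jump rate is zero there.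

For the transport, shifting preserves the class of test functions and its bounds. Testing the weak
equation on shifted functions therefore gives the derivative of the shifted integral at every time,
not only at zero. A test function changes by `O(t)` in the uniform norm during the time `t`, and the
transport term is a bounded family of measures. So the shifted state differs from `μ + t𝒶` by
`O(t²)` in the weighted norm (`abs_integral_shift_sub_le`, `norm1_shift_sub_smul_le`), and Fréchet
differentiability finishes the proof. -/

noncomputable section

/-! ### Signed measures: variation bounds and dominated series. -/

section SignedMeasureBounds

variable {X : Type*} [MeasurableSpace X]

instance isFiniteMeasure_variation (h : SignedMeasure X) : IsFiniteMeasure h.variation := by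
  rw [← SignedMeasure.totalVariation_eq_variation]
  infer_instance

/-- One of the positive and negative parts carries at least half of the variation; hence the factor
two. -/
theorem variation_real_univ_le (h : SignedMeasure X) {C : ℝ} (hC : ∀ A, |h A| ≤ C) :
    h.variation.real univ ≤ 2 * C := by
  have hC0 : 0 ≤ C := (abs_nonneg _).trans (hC univ)
  refine ENNReal.toReal_le_of_le_ofReal (by positivity) (not_lt.1 fun hlt => ?_)
  obtain ⟨t, -, -, ht⟩ := h.exists_subset_lt_enorm_apply_of_lt_variation .univ hlt
  refine absurd ht (not_lt.2 ?_)
  rw [ENNReal.ofReal_mul zero_le_two, ENNReal.ofReal_ofNat, Real.enorm_eq_ofReal_abs]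
  gcongr
  exact hC t

theorem integrable_of_bounded {m : Measure X} [IsFiniteMeasure m] {f : X → ℝ} {b : ℝ}
    (hf : Measurable f) (hb : ∀ x, |f x| ≤ b) : Integrable f m :=
  Integrable.of_bound hf.aestronglyMeasurable b (Eventually.of_forall hb)

theorem abs_integral_signedMeasure_le (h : SignedMeasure X) {C : ℝ} (hC : ∀ A, |h A| ≤ C)
    {f : X → ℝ} {b : ℝ} (hf : Measurable f) (hb : ∀ x, |f x| ≤ b) (hb0 : 0 ≤ b) :
    |∫ᵛ x, f x ∂<•h| ≤ b * (2 * C) := by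
  refine (VectorMeasure.norm_integral_le_integral_norm (f := f) (μ := h)
    (B := (ContinuousLinearMap.lsmul ℝ ℝ (E := ℝ)).flip)).trans ?_
  have h1 : ∫ x, ‖f x‖ ∂h.variation ≤ b * h.variation.real univ := by
    have := integral_mono (μ := h.variation) (integrable_of_bounded hf hb).norm
      (integrable_const b) hb
    simpa [mul_comm] using this
  have h2 : ‖(ContinuousLinearMap.lsmul ℝ ℝ (E := ℝ)).flip‖ ≤ 1 := by
    rw [ContinuousLinearMap.opNorm_flip]; exact ContinuousLinearMap.opNorm_lsmul_le
  calc _ ≤ 1 * ∫ x, ‖f x‖ ∂h.variation := by gcongr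
    _ ≤ b * h.variation.real univ := by rw [one_mul]; exact h1
    _ ≤ _ := by gcongr; exact variation_real_univ_le h hC

/-- A dominated series of signed measures converges setwise to a signed measure. -/
theorem exists_signedMeasure_hasSum {ι : Type*} (h : ι → SignedMeasure X) {c : ι → ℝ}
    (hc : ∀ i A, |h i A| ≤ c i) (hs : Summable c) :
    ∃ g : SignedMeasure X, ∀ A, HasSum (fun i => h i A) (g A) := by
  have hsum : ∀ A, Summable fun i => h i A := fun A =>
    Summable.of_norm_bounded hs fun i => hc i A
  refine ⟨⟨fun A => ∑' i, h i A, by simp, fun A hA => by simp [VectorMeasure.not_measurable _ hA],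
    fun A hA hd => ?_⟩, fun A => (hsum A).hasSum⟩
  have hrow : ∀ i, HasSum (fun n => h i (A n)) (h i (⋃ n, A n)) := fun i =>
    (h i).m_iUnion hA hd
  -- For disjoint sets the variation of `h i` bounds the whole row by `2 * c i`. The double series
  -- is then absolutely summable, and countable additivity of the limit is an exchange of two sums.
  have hbd : ∀ i, (Summable fun n => ‖h i (A n)‖) ∧ ∑' n, ‖h i (A n)‖ ≤ 2 * c i := by
    intro i
    have key : ∀ s : Finset ℕ, ∑ n ∈ s, ‖h i (A n)‖ ≤ 2 * c i := by
      intro s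
      refine le_trans ?_ (variation_real_univ_le (h i) (hc i))
      calc ∑ n ∈ s, ‖h i (A n)‖ ≤ ∑ n ∈ s, (h i).variation.real (A n) :=
            Finset.sum_le_sum fun n _ => VectorMeasure.norm_measure_le_variation
              (μ := h i) (measure_ne_top _ _)
        _ = (h i).variation.real (⋃ n ∈ s, A n) :=
            (measureReal_biUnion_finset (fun m _ n _ hmn => hd hmn) fun n _ => hA n).symm
        _ ≤ _ := measureReal_mono (subset_univ _)
    exact ⟨summable_of_sum_le (fun _ => norm_nonneg _) key,
      Real.tsum_le_of_sum_le (fun _ => norm_nonneg _) key⟩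
  have hprod : Summable fun p : ι × ℕ => h p.1 (A p.2) := by
    refine Summable.of_norm ((summable_prod_of_nonneg fun _ => norm_nonneg _).2
      ⟨fun i => (hbd i).1, ?_⟩)
    exact Summable.of_nonneg_of_le (fun i => tsum_nonneg fun _ => norm_nonneg _)
      (fun i => (hbd i).2) (hs.mul_left 2)
  have h1 := hprod.hasSum.prod_fiberwise hrow
  rw [h1.tsum_eq]
  exact ((Equiv.prodComm ℕ ι).hasSum_iff.2 hprod.hasSum).prod_fiberwise fun n =>
    (hsum (A n)).hasSum

end SignedMeasureBounds

/-! ### The weighted norm, and series of tangent vectors. -/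

section TangentBounds

variable {K V : Type*}

theorem zero_mem_orthant (n : ℕ) : (0 : EuclideanSpace ℝ (Fin n)) ∈ orthant n := fun _ => le_rfl

theorem IsC1.bound_nonneg {f : Queue K V → ℝ} {b d : ℝ} (hf : IsC1 f b d) : 0 ≤ b :=
  (abs_nonneg _).trans (hf.bound ⟨[], fun _ => 0⟩)

theorem IsC1.deriv_bound_nonneg {f : Queue K V → ℝ} {b d : ℝ} (hf : IsC1 f b d) : 0 ≤ d :=
  (norm_nonneg _).trans (hf.deriv_bound [] 0 (zero_mem_orthant _))

/-- The inclusion of the orthant `ℝ₊^n` into the Euclidean space. -/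
def orthantPoint {n : ℕ} (x : Fin n → ℝ≥0) : EuclideanSpace ℝ (Fin n) :=
  WithLp.toLp 2 fun i => (x i : ℝ)

theorem orthantPoint_mem {n : ℕ} (x : Fin n → ℝ≥0) : orthantPoint x ∈ orthant n :=
  fun i => (x i).2

theorem continuous_orthantPoint {n : ℕ} : Continuous (orthantPoint (n := n)) := by
  unfold orthantPoint
  fun_prop

theorem onOrthant_orthantPoint (f : Queue K V → ℝ) (w : List (K × V)) (x : Fin w.length → ℝ≥0) :
    onOrthant f w (orthantPoint x) = f ⟨w, x⟩ := by
  simp [onOrthant, orthantPoint]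

theorem IsC1.measurable {f : Queue K V → ℝ} {b d : ℝ} (hf : IsC1 f b d) : Measurable f := by
  refine Queue.measurable_of_fibers fun w => ?_
  have h : Continuous fun x => onOrthant f w (orthantPoint x) :=
    (hf.contDiffOn w).continuousOn.comp_continuous continuous_orthantPoint orthantPoint_mem
  simpa only [onOrthant_orthantPoint] using h.measurable

theorem norm1_nonneg (h : SignedMeasure (Queue K V)) : 0 ≤ norm1 h := by
  refine Real.sSup_nonneg ?_
  rintro r ⟨f, b, d, -, -, rfl⟩
  exact abs_nonneg _

theorem norm1_le {h : SignedMeasure (Queue K V)} {C : ℝ} (hC : 0 ≤ C)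
    (H : ∀ f b d, IsC1 f b d → b + d ≤ 1 → |∫ᵛ q, f q ∂<•h| ≤ C) : norm1 h ≤ C := by
  refine Real.sSup_le ?_ hC
  rintro r ⟨f, b, d, hf, hbd, rfl⟩
  exact H f b d hf hbd

/-- Test functions in the unit ball are bounded by one, so total variation dominates the dual norm.
This converts the setwise bounds available for the jump terms into the norm in which `L` is
continuous. -/
theorem norm1_le_of_apply_le {h : SignedMeasure (Queue K V)} {C : ℝ} (hC : ∀ A, |h A| ≤ C) :
    norm1 h ≤ 2 * C := by
  have hC0 : 0 ≤ C := (abs_nonneg _).trans (hC univ)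
  refine norm1_le (by positivity) fun f b d hf hbd => ?_
  refine (abs_integral_signedMeasure_le h hC hf.measurable hf.bound hf.bound_nonneg).trans ?_
  have : b ≤ 1 := by linarith [hf.deriv_bound_nonneg]
  nlinarith

/-- The value `h_v(A)` as a linear function of the tangent vector `h`. -/
def tangentEval (v : V) (A : Set (Queue K V)) : tangentSpace K V →ₗ[ℝ] ℝ where
  toFun h := h.1 v A
  map_add' _ _ := rfl
  map_smul' _ _ := rfl

/-- Summability of the majorant matters: a divergent `∑'` is zero, and the inequality could fail. -/
theorem weightedNorm_le {a : V → ℝ} (ha : ∀ v, 0 ≤ a v) {h : tangentSpace K V} {c : V → ℝ}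
    (hc : ∀ v, norm1 (h.1 v) ≤ c v) (hs : Summable fun v => a v * c v) :
    weightedNorm a h ≤ ∑' v, a v * c v := by
  have hle : ∀ v, a v * norm1 (h.1 v) ≤ a v * c v := fun v =>
    mul_le_mul_of_nonneg_left (hc v) (ha v)
  exact (Summable.of_nonneg_of_le (fun v => mul_nonneg (ha v) (norm1_nonneg _)) hle hs).tsum_le_tsum
    hle hs

theorem weightedNorm_nonneg {a : V → ℝ} (ha : ∀ v, 0 ≤ a v) (h : tangentSpace K V) :
    0 ≤ weightedNorm a h :=
  tsum_nonneg fun v => mul_nonneg (ha v) (norm1_nonneg _)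

theorem weightedNorm_le_const {a : V → ℝ} (ha : ∀ v, 0 ≤ a v) (hs : Summable a)
    {h : tangentSpace K V} {c : ℝ} (hc : ∀ v, norm1 (h.1 v) ≤ c) :
    weightedNorm a h ≤ (∑' v, a v) * c := by
  rw [← tsum_mul_right]
  exact weightedNorm_le ha hc (hs.mul_right c)

/-- A dominated series of tangent vectors converges to a tangent vector, and a functional which is
bounded in a weighted norm may be applied term by term. -/
theorem exists_tangent_hasSum {ι : Type*} (h : ι → tangentSpace K V) {c : ι → V → ℝ} {D : ℝ}
    (hc : ∀ i v A, |(h i).1 v A| ≤ c i v) (hs : ∀ v, Summable fun i => c i v)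
    (hD : ∀ v, ∑' i, c i v ≤ D) {a : V → ℝ} (ha : ∀ v, 0 ≤ a v) (hsa : Summable a)
    {L : tangentSpace K V →ₗ[ℝ] ℝ} {C : ℝ} (hL : ∀ h, |L h| ≤ C * weightedNorm a h) :
    ∃ g : tangentSpace K V, (∀ v A, HasSum (fun i => (h i).1 v A) (g.1 v A)) ∧
      HasSum (fun i => L (h i)) (L g) := by
  have hc0 : ∀ i v, 0 ≤ c i v := fun i v => (abs_nonneg _).trans (hc i v univ)
  choose g hg using fun v => exists_signedMeasure_hasSum (fun i => (h i).1 v)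
    (fun i A => hc i v A) (hs v)
  have hgt : g ∈ tangentSpace K V := by
    refine ⟨fun v => ?_, D, fun v A => ?_⟩
    · refine (hg v univ).unique ?_
      simp [(h _).2.1 v]
    · have := (hg v A).norm_le_of_bounded (hs v).hasSum fun i => hc i v A
      exact this.trans (hD v)
  refine ⟨⟨g, hgt⟩, hg, ?_⟩
  -- `T S v` is the mass at the node `v` not yet accounted for by the partial sum over `S`.
  let T : Finset ι → V → ℝ := fun S v => ∑' i : {i // i ∉ S}, c i v
  have hrem : ∀ S v A, |((⟨g, hgt⟩ - ∑ i ∈ S, h i : tangentSpace K V)).1 v A| ≤ T S v := by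
    intro S v A
    have hval := (tangentEval v A).map_sub ⟨g, hgt⟩ (∑ i ∈ S, h i)
    rw [map_sum] at hval
    change |tangentEval v A (⟨g, hgt⟩ - ∑ i ∈ S, h i)| ≤ T S v
    rw [hval]
    change |g v A - ∑ i ∈ S, (h i).1 v A| ≤ T S v
    refine HasSum.norm_le_of_bounded (f := fun i : {i // i ∉ S} => (h i.1).1 v A) ?_
      ((hs v).subtype fun i => i ∉ S).hasSum
      (fun i => hc i.1 v A)
    refine (Finset.hasSum_compl_iff (f := fun i => (h i).1 v A) S).2 ?_
    rw [sub_add_cancel]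
    exact hg v A
  have hTD : ∀ S v, T S v ≤ D := fun S v =>
    ((hs v).tsum_subtype_le _ _ (fun i => hc0 i v)).trans (hD v)
  have hT0 : ∀ S v, 0 ≤ T S v := fun S v => tsum_nonneg fun i => hc0 i v
  -- The tails vanish at each node, not uniformly in the node. The uniform bound `D` and the
  -- summable weights supply the majorant `a v * (2 * D)`.
  have hlim : Tendsto (fun S => ∑' v, a v * (2 * T S v)) atTop (𝓝 (∑' v, a v * (2 * 0))) := by
    refine tendsto_tsum_of_dominated_convergence (hsa.mul_right (2 * D)) (fun v => ?_)
      (Eventually.of_forall fun S v => ?_)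
    · exact ((tendsto_tsum_compl_atTop_zero fun i => c i v).const_mul 2).const_mul (a v)
    · rw [Real.norm_of_nonneg (mul_nonneg (ha v) (mul_nonneg zero_le_two (hT0 S v)))]
      exact mul_le_mul_of_nonneg_left (mul_le_mul_of_nonneg_left (hTD S v) zero_le_two) (ha v)
  have hbound : ∀ S, |L ⟨g, hgt⟩ - ∑ i ∈ S, L (h i)| ≤ |C| * ∑' v, a v * (2 * T S v) := by
    intro S
    rw [← map_sum, ← map_sub]
    refine (hL _).trans ?_
    refine mul_le_mul (le_abs_self C) (weightedNorm_le ha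
      (fun v => norm1_le_of_apply_le (hrem S v)) ?_) (weightedNorm_nonneg ha _) (abs_nonneg C)
    exact Summable.of_nonneg_of_le
      (fun v => mul_nonneg (ha v) (mul_nonneg zero_le_two (hT0 S v)))
      (fun v => mul_le_mul_of_nonneg_left (mul_le_mul_of_nonneg_left (hTD S v) zero_le_two) (ha v))
      (hsa.mul_right (2 * D))
  have hlim' := hlim.const_mul |C|
  simp only [mul_zero, tsum_zero] at hlim'
  have := squeeze_zero_norm (f := fun S => L ⟨g, hgt⟩ - ∑ i ∈ S, L (h i)) hbound hlim'
  simpa [HasSum] using (tendsto_const_nhds (x := L ⟨g, hgt⟩)).sub this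

end TangentBounds

namespace JumpingNetwork

variable {K V : Type*} (net : JumpingNetwork K V)

/-! ### Rates -/

theorem hazard_nonneg (κ : K) (v : V) (τ : ℝ) : 0 ≤ net.hazard κ v τ :=
  div_nonneg ((ProbabilityTheory.monotone_cdf _).monotoneOn _).derivWithin_nonneg
    (sub_nonneg.2 (net.service_lt_one κ v τ).le)

theorem exists_hazard_le : ∃ B : ℝ, 0 ≤ B ∧ ∀ κ v (τ : ℝ≥0), net.hazard κ v τ ≤ B := by
  obtain ⟨b, hb⟩ := net.service_bounded
  exact ⟨max b 0, le_max_right _ _, fun κ v τ => (hb κ v τ τ.2).trans (le_max_left _ _)⟩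

/-- By differentiability, the derivative within `Ici 0` at `τ` is the right derivative at `τ`, and
right derivatives are measurable functions of the point. -/
theorem measurable_hazard (κ : K) (v : V) : Measurable fun τ : ℝ≥0 => net.hazard κ v τ := by
  have h : (fun τ : ℝ≥0 => net.hazard κ v τ) = fun τ : ℝ≥0 =>
      derivWithin (ProbabilityTheory.cdf (net.service κ v : Measure ℝ)) (Ici (τ : ℝ)) τ /
        (1 - ProbabilityTheory.cdf (net.service κ v : Measure ℝ) τ) := by
    funext τ
    have hd := (net.service_differentiable κ v τ τ.2).hasDerivWithinAt
    have hs : Ici (τ : ℝ) ⊆ Ici 0 := Ici_subset_Ici.2 τ.2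
    rw [hazard, (hd.mono hs).derivWithin (uniqueDiffOn_Ici _ _ self_mem_Ici)]
  rw [h]
  have hm : Measurable (ProbabilityTheory.cdf (net.service κ v : Measure ℝ)) :=
    (ProbabilityTheory.monotone_cdf _).measurable
  exact ((measurable_derivWithin_Ici _).comp measurable_subtype_coe).div
    ((hm.comp measurable_subtype_coe).const_sub 1)

theorem served_mk (v : V) (w : List (K × V)) (x : Fin w.length → ℝ≥0) :
    net.served v (⟨w, x⟩ : Queue K V) = net.served v (⟨w, 0⟩ : Queue K V) := rfl

/-- The discipline looks only at the word, so such a set is a union of whole orthants. -/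
theorem measurableSet_served (v : V) (p : Option (K × V) → Prop) :
    MeasurableSet {q : Queue K V | p (net.served v q)} := by
  refine MeasurableSpace.measurableSet_iInf.2 fun w => ?_
  change MeasurableSet {_x : Fin w.length → ℝ≥0 | p (net.served v (⟨w, 0⟩ : Queue K V))}
  exact MeasurableSet.const _

theorem measurable_serviceRate (v : V) : Measurable (net.serviceRate v) := by
  refine Queue.measurable_of_fibers fun w => ?_
  simp only [serviceRate, served_mk]
  cases net.served v (⟨w, 0⟩ : Queue K V) with
  | none => exact measurable_const
  | some c => exact (net.measurable_hazard c.1 v).comp (Queue.measurable_attained w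
      (net.servedIdx v (⟨w, 0⟩ : Queue K V)))

theorem serviceRate_nonneg (v : V) (q : Queue K V) : 0 ≤ net.serviceRate v q := by
  unfold serviceRate
  split
  · exact le_rfl
  · exact net.hazard_nonneg _ _ _

theorem exists_serviceRate_le : ∃ B : ℝ, 0 ≤ B ∧ ∀ v q, net.serviceRate v q ≤ B := by
  obtain ⟨B, hB0, hB⟩ := net.exists_hazard_le
  refine ⟨B, hB0, fun v q => ?_⟩
  unfold serviceRate
  split
  · exact hB0
  · exact hB _ _ _

theorem mem_nbrs {v u : V} : u ∈ net.nbrs v ↔ net.graph.Adj v u := by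
  simp [nbrs]

theorem card_nbrs (v : V) : (net.nbrs v).card = (net.graph.neighborSet v).ncard :=
  (ncard_eq_toFinset_card _ _).symm

/-- The first step of a geodesic is one closer to its end. Thus `closerCount` is nonzero and the
routing probabilities are normalised. -/
theorem exists_closer {v d : V} (h : 1 < net.graph.dist v d) :
    ∃ u, net.graph.Adj v u ∧ net.graph.dist v d = net.graph.dist u d + 1 := by
  obtain ⟨p, hp⟩ := (net.connected.preconnected v d).exists_walk_length_eq_dist
  cases p with
  | nil => simp at h
  | @cons _ u _ hadj r =>
    refine ⟨u, hadj, le_antisymm ?_ ?_⟩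
    · have h1 := net.connected.dist_triangle (u := v) (v := u) (w := d)
      have h2 : net.graph.dist v u = 1 := SimpleGraph.dist_eq_one_iff_adj.2 hadj
      omega
    · rw [← hp, SimpleGraph.Walk.length_cons]
      exact Nat.succ_le_succ (SimpleGraph.dist_le r)

theorem routing_nonneg (v d u : V) : 0 ≤ net.routing v d u := by
  unfold routing
  split_ifs <;> positivity

theorem routing_le_one (v d u : V) : net.routing v d u ≤ 1 := by
  unfold routing
  split_ifs
  · rw [one_div]
    exact Nat.cast_inv_le_one _
  · exact zero_le_one

theorem routing_eq_zero {v d u : V} (h : ¬ 1 < net.graph.dist v d) : net.routing v d u = 0 :=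
  if_neg fun h' => h h'.1

theorem sum_routing {v d : V} (h : 1 < net.graph.dist v d) :
    ∑ u ∈ net.nbrs v, net.routing v d u = 1 := by
  classical
  have hpos : (net.closerCount v d : ℝ) ≠ 0 := by
    obtain ⟨u, hu, hd⟩ := net.exists_closer h
    refine Nat.cast_ne_zero.2 (Finset.card_ne_zero.2 ⟨u, ?_⟩)
    exact Finset.mem_filter.2 ⟨net.mem_nbrs.2 hu, hd⟩
  have h1 : ∀ u ∈ net.nbrs v, net.routing v d u =
      if net.graph.dist v d = net.graph.dist u d + 1 then 1 / (net.closerCount v d : ℝ) else 0 :=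
    fun u hu => by simp only [routing, h, net.mem_nbrs.1 hu, true_and]
  rw [Finset.sum_congr rfl h1, ← Finset.sum_filter, Finset.sum_const, nsmul_eq_mul]
  have hcard : ((net.nbrs v).filter fun u =>
      net.graph.dist v d = net.graph.dist u d + 1).card = net.closerCount v d := by
    unfold closerCount
    congr
  rw [hcard, mul_one_div_cancel hpos]

theorem jumpRate_of_served {v : V} {q : Queue K V} {c : K × V} (h : net.served v q = some c)
    (u : V) : net.jumpRate v u q = net.routing v c.2 u * net.serviceRate v q := by
  simp only [jumpRate, h]

theorem jumpRate_of_served_none {v : V} {q : Queue K V} (h : net.served v q = none) (u : V) :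
    net.jumpRate v u q = 0 := by
  simp only [jumpRate, h]

theorem serviceRate_of_served_none {v : V} {q : Queue K V} (h : net.served v q = none) :
    net.serviceRate v q = 0 := by
  simp only [serviceRate, h]

theorem jumpRate_nonneg (v u : V) (q : Queue K V) : 0 ≤ net.jumpRate v u q := by
  unfold jumpRate
  split
  · exact le_rfl
  · exact mul_nonneg (net.routing_nonneg _ _ _) (net.serviceRate_nonneg _ _)

theorem jumpRate_le (v u : V) (q : Queue K V) : net.jumpRate v u q ≤ net.serviceRate v q := by
  unfold jumpRate
  split
  · exact net.serviceRate_nonneg _ _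
  · exact mul_le_of_le_one_left (net.serviceRate_nonneg _ _) (net.routing_le_one _ _ _)

theorem measurable_jumpRate (v u : V) : Measurable (net.jumpRate v u) := by
  refine Queue.measurable_of_fibers fun w => ?_
  simp only [jumpRate, served_mk]
  cases net.served v (⟨w, 0⟩ : Queue K V) with
  | none => exact measurable_const
  | some c => exact ((net.measurable_serviceRate v).comp (Queue.measurable_mk w)).const_mul _

/-- A customer jumps only if it is at distance at least two from its destination. -/
theorem exists_served_of_jumpRate_ne_zero {v u : V} {q : Queue K V} (h : net.jumpRate v u q ≠ 0) :
    ∃ c, net.served v q = some c ∧ c.2 ≠ u := by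
  cases hs : net.served v q with
  | none => exact absurd (net.jumpRate_of_served_none hs u) h
  | some c =>
    refine ⟨c, rfl, ?_⟩
    rintro rfl
    rw [net.jumpRate_of_served hs] at h
    refine h (mul_eq_zero_of_left (if_neg ?_) _)
    rintro ⟨h1, h2, -⟩
    rw [SimpleGraph.dist_eq_one_iff_adj.2 h2] at h1
    exact lt_irrefl _ h1

theorem zeta_of_served {v u : V} {q : Queue K V} {c : K × V} (h : net.served v q = some c)
    (hc : c.2 ≠ u) (q' : Queue K V) :
    net.zeta v u (q, q') = (net.depart v q, q'.arrive (net.newClass c.1 v u, c.2)) := by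
  simp only [zeta, h, hc, if_false]

/-- Jumps to the neighbours and exits add up to service completions. -/
theorem jump_add_exit (v : V) (q : Queue K V) (f : Queue K V → ℝ) :
    ∑ u ∈ net.nbrs v, net.jumpRate v u q * (f (net.depart v q) - f q) +
        net.serviceRate v q * (f (net.psiNN v q) - f q) =
      net.serviceRate v q * (f (net.depart v q) - f q) := by
  rw [← Finset.sum_mul]
  cases hs : net.served v q with
  | none => simp [net.serviceRate_of_served_none hs, net.jumpRate_of_served_none hs]
  | some c =>
    simp only [net.jumpRate_of_served hs, ← Finset.sum_mul]
    by_cases hd : 1 < net.graph.dist v c.2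
    · simp [net.sum_routing hd, psiNN, hs, not_le.2 hd]
    · simp [net.routing_eq_zero hd, psiNN, hs, not_lt.1 hd]

/-! ### The marginals of the jump flux -/

theorem integrable_serviceRate (v : V) (m : Measure (Queue K V)) [IsFiniteMeasure m] :
    Integrable (net.serviceRate v) m := by
  obtain ⟨B, -, hB⟩ := net.exists_serviceRate_le
  exact integrable_of_bounded (net.measurable_serviceRate v)
    fun q => by rw [abs_of_nonneg (net.serviceRate_nonneg v q)]; exact hB v q

theorem integrable_jumpRate (v u : V) (m : Measure (Queue K V)) [IsFiniteMeasure m] :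
    Integrable (net.jumpRate v u) m :=
  (net.integrable_serviceRate v m).mono' (net.measurable_jumpRate v u).aestronglyMeasurable
    (Eventually.of_forall fun q => by
      rw [Real.norm_of_nonneg (net.jumpRate_nonneg v u q)]; exact net.jumpRate_le v u q)

theorem integrable_jumpRate_fst (v u : V) (μ : NetState K V) :
    Integrable (fun p : Queue K V × Queue K V => net.jumpRate v u p.1)
      ((μ v : Measure (Queue K V)).prod (μ u : Measure (Queue K V))) :=
  (net.integrable_jumpRate v u _).comp_fst _

theorem jumpFlux_apply [Countable K] (v u : V) (μ : NetState K V)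
    {S : Set (Queue K V × Queue K V)} (hS : MeasurableSet S) :
    net.jumpFlux v u μ S =
      ∫ p in net.zeta v u ⁻¹' S, net.jumpRate v u p.1
          ∂((μ v : Measure (Queue K V)).prod (μ u : Measure (Queue K V))) -
        ∫ p in S, net.jumpRate v u p.1
          ∂((μ v : Measure (Queue K V)).prod (μ u : Measure (Queue K V))) := by
  have hi := net.integrable_jumpRate_fst v u μ
  rw [jumpFlux, _root_.sub_apply, VectorMeasure.map_apply _ (net.measurable_zeta v u) hS,
    withDensityᵥ_apply hi (net.measurable_zeta v u hS), withDensityᵥ_apply hi hS]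

theorem setIntegral_mem_Icc {X : Type*} [MeasurableSpace X] (m : Measure X)
    [IsProbabilityMeasure m] {f : X → ℝ} {B : ℝ} (hf : Measurable f) (h0 : ∀ x, 0 ≤ f x)
    (hB : ∀ x, f x ≤ B) (S : Set X) : ∫ x in S, f x ∂m ∈ Icc 0 B := by
  refine ⟨integral_nonneg h0, ?_⟩
  have hi : Integrable f m := integrable_of_bounded hf
    fun x => by rw [abs_of_nonneg (h0 x)]; exact hB x
  calc ∫ x in S, f x ∂m ≤ ∫ x, f x ∂m :=
        setIntegral_le_integral hi (Eventually.of_forall h0)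
    _ ≤ ∫ _, B ∂m := integral_mono hi (integrable_const B) hB
    _ = B := by simp

theorem abs_jumpFlux_le [Countable K] {B : ℝ} (hB : ∀ v q, net.serviceRate v q ≤ B) (v u : V)
    (μ : NetState K V) (S : Set (Queue K V × Queue K V)) : |net.jumpFlux v u μ S| ≤ B := by
  have key := setIntegral_mem_Icc
    ((μ v : Measure (Queue K V)).prod (μ u : Measure (Queue K V)))
    ((net.measurable_jumpRate v u).comp measurable_fst)
    (fun p => net.jumpRate_nonneg v u p.1) (fun p => (net.jumpRate_le v u p.1).trans (hB v p.1))
  by_cases hS : MeasurableSet S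
  · rw [net.jumpFlux_apply v u μ hS]
    -- Both integrals lie in `[0, B]`, so their difference costs `B` and not `2 * B`.
    simpa using abs_sub_le_of_le_of_le (key (net.zeta v u ⁻¹' S)).1 (key (net.zeta v u ⁻¹' S)).2
      (key S).1 (key S).2
  · rw [VectorMeasure.not_measurable _ hS, abs_zero]
    exact (key univ).1.trans (key univ).2

theorem setIntegral_fst_prod {X Y : Type*} [MeasurableSpace X] [MeasurableSpace Y] (m : Measure X)
    (n : Measure Y) [IsProbabilityMeasure m] [IsProbabilityMeasure n] {f : X → ℝ}
    (hf : Measurable f) {A : Set X} (hA : MeasurableSet A) :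
    ∫ p in Prod.fst ⁻¹' A, f p.1 ∂(m.prod n) = ∫ x in A, f x ∂m := by
  have h := setIntegral_map (μ := m.prod n) hA hf.aestronglyMeasurable
    (measurable_fst (α := X) (β := Y)).aemeasurable
  rw [Measure.map_fst_prod, measure_univ, one_smul] at h
  exact h.symm

/-- The first marginal of the jump flux: departures from `v` to `u`. -/
theorem jumpFlux_fst [Countable K] (v u : V) (μ : NetState K V) {A : Set (Queue K V)}
    (hA : MeasurableSet A) :
    (net.jumpFlux v u μ).map Prod.fst A =
      ∫ q in net.depart v ⁻¹' A, net.jumpRate v u q ∂(μ v : Measure (Queue K V)) -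
        ∫ q in A, net.jumpRate v u q ∂(μ v : Measure (Queue K V)) := by
  have hm := net.measurable_jumpRate v u
  rw [VectorMeasure.map_apply _ measurable_fst hA, net.jumpFlux_apply v u μ (measurable_fst hA),
    setIntegral_fst_prod _ _ hm hA,
    ← setIntegral_fst_prod _ (μ u : Measure (Queue K V)) hm (net.measurable_depart v hA),
    ← integral_indicator (net.measurable_zeta v u (measurable_fst hA)),
    ← integral_indicator (measurable_fst (net.measurable_depart v hA))]
  congr 2
  funext ⟨q, q'⟩
  classical
  -- Pointwise comparison: where the rate is nonzero, the first component of `zeta` is `depart`;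
  -- elsewhere both integrands vanish.
  by_cases h : net.jumpRate v u q = 0
  · simp [indicator_apply, h]
  · obtain ⟨c, hc, hcu⟩ := net.exists_served_of_jumpRate_ne_zero h
    simp [indicator_apply, net.zeta_of_served hc hcu]

open Classical in
/-- The rate at which the customer served in the queue `q` at `v` arrives to `u` with the
label `c`. -/
def transitDensity (v u : V) (c : K × V) (q : Queue K V) : ℝ :=
  match net.served v q with
  | none => 0
  | some c' => if net.newClass c'.1 v u = c.1 ∧ c'.2 = c.2 then net.jumpRate v u q else 0

theorem transitRate_eq (μ : NetState K V) (u : V) (c : K × V) :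
    net.transitRate μ u c =
      ∑ v ∈ net.nbrs u, ∫ q, net.transitDensity v u c q ∂(μ v : Measure (Queue K V)) := rfl

/-- The queues whose customer in service would arrive to `u` with the label `c`. -/
def transitSet (v u : V) (c : K × V) : Set (Queue K V) :=
  {q | ∃ c', net.served v q = some c' ∧ (net.newClass c'.1 v u, c'.2) = c}

theorem measurableSet_transitSet (v u : V) (c : K × V) : MeasurableSet (net.transitSet v u c) :=
  net.measurableSet_served v fun o => ∃ c', o = some c' ∧ (net.newClass c'.1 v u, c'.2) = c

theorem transitDensity_eq_indicator (v u : V) (c : K × V) :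
    net.transitDensity v u c = (net.transitSet v u c).indicator (net.jumpRate v u) := by
  classical
  funext q
  unfold transitDensity
  cases hs : net.served v q with
  | none => simp [transitSet, hs]
  | some c' => simp [indicator_apply, transitSet, hs, Prod.ext_iff, and_comm]

theorem integral_transitDensity (v u : V) (c : K × V) (m : Measure (Queue K V)) :
    ∫ q, net.transitDensity v u c q ∂m = ∫ q in net.transitSet v u c, net.jumpRate v u q ∂m := by
  rw [transitDensity_eq_indicator, integral_indicator (net.measurableSet_transitSet v u c)]

theorem integral_transitDensity_nonneg (v u : V) (c : K × V) (m : Measure (Queue K V)) :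
    0 ≤ ∫ q, net.transitDensity v u c q ∂m := by
  rw [integral_transitDensity]
  exact integral_nonneg fun q => net.jumpRate_nonneg v u q

/-- Once the label `c` of the arriving customer is fixed, membership in `S` depends on the second
queue only, so the integral over the product measure factorises. The family `T` is left free to
cover gain (`arrive c` preimages), loss (the set itself) and the total rate (the whole space). -/
theorem hasSum_transit [Countable K] (v u : V) (μ : NetState K V)
    {S : Set (Queue K V × Queue K V)} (hS : MeasurableSet S) {T : K × V → Set (Queue K V)}
    (hT : ∀ c, MeasurableSet (T c))
    (h : ∀ p : Queue K V × Queue K V, ∀ c', net.served v p.1 = some c' → c'.2 ≠ u →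
      (p ∈ S ↔ p.2 ∈ T (net.newClass c'.1 v u, c'.2))) :
    HasSum (fun c => (∫ q, net.transitDensity v u c q ∂(μ v : Measure (Queue K V))) *
        (μ u : Measure (Queue K V)).real (T c))
      (∫ p in S, net.jumpRate v u p.1
        ∂((μ v : Measure (Queue K V)).prod (μ u : Measure (Queue K V)))) := by
  have := net.countable_nodes
  have hi := net.integrable_jumpRate_fst v u μ
  have hU : ∀ c, MeasurableSet (S ∩ Prod.fst ⁻¹' net.transitSet v u c) := fun c =>
    hS.inter (measurable_fst (net.measurableSet_transitSet v u c))
  have hsum := hasSum_integral_iUnion hU (fun c₁ c₂ hne => ?_) hi.integrableOn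
  -- The transit sets exhaust the queues with nonzero jump rate, so nothing is lost by summing over
  -- labels.
  · have hfull : ∫ p in ⋃ c, S ∩ Prod.fst ⁻¹' net.transitSet v u c, net.jumpRate v u p.1
          ∂((μ v : Measure (Queue K V)).prod (μ u : Measure (Queue K V))) =
        ∫ p in S, net.jumpRate v u p.1
          ∂((μ v : Measure (Queue K V)).prod (μ u : Measure (Queue K V))) := by
      refine Eq.symm <| setIntegral_eq_of_subset_of_forall_sdiff_eq_zero hS
        (iUnion_subset fun c => inter_subset_left) fun p hp => ?_
      by_contra hne
      obtain ⟨c, hc, -⟩ := net.exists_served_of_jumpRate_ne_zero hne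
      exact hp.2 (mem_iUnion.2 ⟨_, hp.1, c, hc, rfl⟩)
    rw [hfull] at hsum
    refine hsum.congr_fun fun c => ?_
    have hrect := setIntegral_prod_mul (μ := (μ v : Measure (Queue K V)))
      (ν := (μ u : Measure (Queue K V))) (net.jumpRate v u) (fun _ => (1 : ℝ))
      (net.transitSet v u c) (T c)
    rw [integral_transitDensity]
    simp only [mul_one, setIntegral_const, smul_eq_mul] at hrect
    rw [← hrect, ← integral_indicator ((net.measurableSet_transitSet v u c).prod (hT c)),
      ← integral_indicator (hU c)]
    congr 1
    funext p
    classical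
    by_cases hj : net.jumpRate v u p.1 = 0
    · simp [indicator_apply, hj]
    · obtain ⟨c', hc', hcu⟩ := net.exists_served_of_jumpRate_ne_zero hj
      have hp := h p c' hc' hcu
      have : p ∈ net.transitSet v u c ×ˢ T c ↔ p ∈ S ∩ Prod.fst ⁻¹' net.transitSet v u c := by
        simp only [mem_prod, mem_inter_iff, mem_preimage, transitSet, mem_ofPred_eq, hc',
          Option.some.injEq, exists_eq_left']
        constructor
        · rintro ⟨rfl, h2⟩
          exact ⟨hp.2 h2, rfl⟩
        · rintro ⟨h2, rfl⟩
          exact ⟨rfl, hp.1 h2⟩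
      simp only [indicator_apply, this]
  · refine disjoint_left.2 ?_
    rintro p ⟨-, c, hc, h1⟩ ⟨-, c', hc', h2⟩
    rw [hc] at hc'
    obtain rfl := Option.some.inj hc'
    exact hne (h1.symm.trans h2)

theorem hasSum_integral_transitDensity [Countable K] (v u : V) (μ : NetState K V) :
    HasSum (fun c => ∫ q, net.transitDensity v u c q ∂(μ v : Measure (Queue K V)))
      (∫ p, net.jumpRate v u p.1
        ∂((μ v : Measure (Queue K V)).prod (μ u : Measure (Queue K V)))) := by
  simpa using net.hasSum_transit v u μ .univ (T := fun _ => univ) (fun _ => .univ) (by simp)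

/-- The second marginal of the jump flux: transit arrivals to `u` from `v`. -/
theorem jumpFlux_snd [Countable K] (v u : V) (μ : NetState K V) {A : Set (Queue K V)}
    (hA : MeasurableSet A) :
    HasSum (fun c => (∫ q, net.transitDensity v u c q ∂(μ v : Measure (Queue K V))) *
        ((μ u : Measure (Queue K V)).real (Queue.arrive c ⁻¹' A) -
          (μ u : Measure (Queue K V)).real A))
      ((net.jumpFlux v u μ).map Prod.snd A) := by
  rw [VectorMeasure.map_apply _ measurable_snd hA, net.jumpFlux_apply v u μ (measurable_snd hA)]
  simp only [mul_sub]
  refine (net.hasSum_transit v u μ (net.measurable_zeta v u (measurable_snd hA))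
    (fun c => Queue.measurable_arrive c hA) ?_).sub
    (net.hasSum_transit v u μ (measurable_snd hA) (fun _ => hA) fun p c' _ _ => Iff.rfl)
  rintro ⟨q, q'⟩ c' hc' hcu
  simp [net.zeta_of_served hc' hcu]

end JumpingNetwork

section Tangent

variable {K V : Type*}

open Classical in
theorem tangentSingle_apply (w : V) (s : SignedMeasure (Queue K V)) (hs : s univ = 0) (v : V)
    (A : Set (Queue K V)) :
    (tangentSingle w s hs).1 v A = if v = w then s A else 0 := by
  change (Pi.single w s : V → SignedMeasure (Queue K V)) v A = _
  rw [Pi.single_apply]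
  split_ifs <;> rfl

theorem real_mem_Icc (m : ProbabilityMeasure (Queue K V)) (A : Set (Queue K V)) :
    (m : Measure (Queue K V)).real A ∈ Icc (0 : ℝ) 1 :=
  ⟨measureReal_nonneg, measureReal_le_one⟩

end Tangent

namespace JumpingNetwork

variable {K V : Type*} (net : JumpingNetwork K V)

theorem exists_card_nbrs_le : ∃ d : ℕ, ∀ v, (net.nbrs v).card ≤ d := by
  obtain ⟨d, hd⟩ := net.bounded_degree
  exact ⟨d, fun v => (net.card_nbrs v).trans_le (hd v)⟩

theorem mem_nbrs_comm {v u : V} : u ∈ net.nbrs v ↔ v ∈ net.nbrs u := by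
  rw [mem_nbrs, mem_nbrs, SimpleGraph.adj_comm]

/-! ### Arrivals -/

open Classical in
theorem arrivalTangent_apply (w : V) (c : K × V) (μ : NetState K V) (v : V)
    {A : Set (Queue K V)} (hA : MeasurableSet A) :
    (arrivalTangent w c μ).1 v A = if v = w then
      (μ w : Measure (Queue K V)).real (Queue.arrive c ⁻¹' A) -
        (μ w : Measure (Queue K V)).real A else 0 := by
  rw [arrivalTangent, tangentSingle_apply, _root_.sub_apply,
    VectorMeasure.map_apply _ (Queue.measurable_arrive c) hA,
    Measure.toSignedMeasure_apply_measurable (Queue.measurable_arrive c hA),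
    Measure.toSignedMeasure_apply_measurable hA]

open Classical in
theorem abs_arrivalTangent_le (w : V) (c : K × V) (μ : NetState K V) (v : V)
    (A : Set (Queue K V)) : |(arrivalTangent w c μ).1 v A| ≤ if v = w then 1 else 0 := by
  by_cases hA : MeasurableSet A
  · rw [arrivalTangent_apply _ _ _ _ hA]
    split_ifs
    · have h1 := real_mem_Icc (μ w) (Queue.arrive c ⁻¹' A)
      have h2 := real_mem_Icc (μ w) A
      simpa using abs_sub_le_of_le_of_le h1.1 h1.2 h2.1 h2.2
    · simp
  · rw [VectorMeasure.not_measurable _ hA, abs_zero]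
    split_ifs <;> norm_num

section Functional

variable {a : V → ℝ} (ha : ∀ v, 0 ≤ a v) (hsa : Summable a)
  {L : tangentSpace K V →ₗ[ℝ] ℝ} {C : ℝ} (hL : ∀ h, |L h| ≤ C * weightedNorm a h)
  (μ : NetState K V)

include ha hsa hL

/-- The sum of the arrival terms. -/
theorem exists_arrival_sum :
    ∃ g : tangentSpace K V, (∀ v A, MeasurableSet A → HasSum
        (fun c : K × V => net.lam c.1 v c.2 *
          ((μ v : Measure (Queue K V)).real (Queue.arrive c ⁻¹' A) -
            (μ v : Measure (Queue K V)).real A)) (g.1 v A)) ∧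
      HasSum (net.arrivalTerm L μ) (L g) := by
  classical
  obtain ⟨b, hb⟩ := net.lam_bounded
  -- At a fixed node, the series over pairs (node, label) reduces to the series over labels.
  have hsupp : ∀ v (f : K × V → ℝ) (s : ℝ), HasSum (fun p : V × (K × V) =>
      if v = p.1 then f p.2 else 0) s ↔ HasSum f s := by
    intro v f s
    rw [← (Prod.mk_right_injective v).hasSum_iff
      (f := fun p : V × (K × V) => if v = p.1 then f p.2 else 0)]
    · simp [Function.comp_def]
    · rintro ⟨w, c⟩ hp
      refine if_neg ?_
      rintro rfl
      exact hp ⟨c, rfl⟩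
  have hlam : ∀ v, HasSum (fun p : V × (K × V) => if v = p.1 then net.lam p.2.1 v p.2.2 else 0)
      (∑' c : K × V, net.lam c.1 v c.2) := fun v =>
    (hsupp v (fun c => net.lam c.1 v c.2) _).2 (net.lam_summable v).hasSum
  have hbd : ∀ (p : V × (K × V)) v A,
      |(net.lam p.2.1 p.1 p.2.2 • arrivalTangent p.1 p.2 μ : tangentSpace K V).1 v A| ≤
        if v = p.1 then net.lam p.2.1 v p.2.2 else 0 := by
    intro p v A
    change |net.lam p.2.1 p.1 p.2.2 * (arrivalTangent p.1 p.2 μ).1 v A| ≤ _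
    rw [abs_mul, abs_of_nonneg (net.lam_nonneg _ _ _)]
    refine (mul_le_mul_of_nonneg_left (abs_arrivalTangent_le _ _ μ v A)
      (net.lam_nonneg _ _ _)).trans_eq ?_
    split_ifs with h
    · rw [h, mul_one]
    · rw [mul_zero]
  obtain ⟨g, hg, hLg⟩ := exists_tangent_hasSum
    (fun p : V × (K × V) => net.lam p.2.1 p.1 p.2.2 • arrivalTangent p.1 p.2 μ)
    (c := fun p v => if v = p.1 then net.lam p.2.1 v p.2.2 else 0) (D := b)
    hbd (fun v => (hlam v).summable)
    (fun v => (hlam v).tsum_eq.trans_le (hb v).le) ha hsa hL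
  · refine ⟨g, fun v A hA => ?_, ?_⟩
    · refine (hsupp v _ _).1 ((hg v A).congr_fun fun p => ?_)
      change _ = net.lam p.2.1 p.1 p.2.2 * (arrivalTangent p.1 p.2 μ).1 v A
      rw [arrivalTangent_apply _ _ _ _ hA]
      split_ifs with h
      · rw [h]
      · rw [mul_zero]
    · exact hLg.congr_fun fun p => (L.map_smul _ _).symm

/-- The sum of tangent vectors, one for each node, that are concentrated at their nodes. -/
theorem exists_diagonal_sum {h : V → tangentSpace K V} {D : ℝ}
    (hD : ∀ v A, |(h v).1 v A| ≤ D) (h0 : ∀ w v, v ≠ w → ∀ A, (h w).1 v A = 0) :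
    ∃ g : tangentSpace K V, (∀ v A, g.1 v A = (h v).1 v A) ∧
      HasSum (fun v => L (h v)) (L g) := by
  classical
  have hbd : ∀ w v A, |(h w).1 v A| ≤ if w = v then D else 0 := by
    intro w v A
    split_ifs with hwv
    · subst hwv
      exact hD _ A
    · rw [h0 w v (Ne.symm hwv) A, abs_zero]
  obtain ⟨g, hg, hLg⟩ := exists_tangent_hasSum h
    (c := fun w v => if w = v then D else 0) (D := D) hbd
    (fun v => (hasSum_ite_eq v D).summable) (fun v => (tsum_ite_eq v _).le) ha hsa hL
  · exact ⟨g, fun v A => (hg v A).unique (hasSum_single v fun w hw => h0 w v hw.symm A), hLg⟩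

/-! ### Exits -/

omit ha hsa hL in
open Classical in
theorem exitTangent_apply (w : V) (v : V) {A : Set (Queue K V)} (hA : MeasurableSet A) :
    (net.exitTangent w μ).1 v A = if v = w then
      ∫ q in net.psiNN w ⁻¹' A, net.serviceRate w q ∂(μ w : Measure (Queue K V)) -
        ∫ q in A, net.serviceRate w q ∂(μ w : Measure (Queue K V)) else 0 := by
  have hi := net.integrable_serviceRate w (μ w : Measure (Queue K V))
  rw [exitTangent, tangentSingle_apply, _root_.sub_apply,
    VectorMeasure.map_apply _ (net.measurable_psiNN w) hA, withDensityᵥ_apply hi hA,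
    withDensityᵥ_apply hi (net.measurable_psiNN w hA)]

theorem exists_exit_sum :
    ∃ g : tangentSpace K V, (∀ v A, MeasurableSet A → g.1 v A =
        ∫ q in net.psiNN v ⁻¹' A, net.serviceRate v q ∂(μ v : Measure (Queue K V)) -
          ∫ q in A, net.serviceRate v q ∂(μ v : Measure (Queue K V))) ∧
      HasSum (net.exitTerm L μ) (L g) := by
  classical
  obtain ⟨B, hB0, hB⟩ := net.exists_serviceRate_le
  have hbd : ∀ v A, |(net.exitTangent v μ).1 v A| ≤ B := by
    intro v A
    by_cases hA : MeasurableSet A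
    · rw [exitTangent_apply _ _ _ _ hA, if_pos rfl]
      have key := setIntegral_mem_Icc (μ v : Measure (Queue K V)) (net.measurable_serviceRate v)
        (net.serviceRate_nonneg v) (hB v)
      simpa using abs_sub_le_of_le_of_le (key (net.psiNN v ⁻¹' A)).1
        (key (net.psiNN v ⁻¹' A)).2 (key A).1 (key A).2
    · rwa [VectorMeasure.not_measurable _ hA, abs_zero]
  have h0 : ∀ w v, v ≠ w → ∀ A, (net.exitTangent w μ).1 v A = 0 := fun w v hne A => by
    rw [exitTangent, tangentSingle_apply, if_neg hne]
  obtain ⟨g, hg, hLg⟩ := exists_diagonal_sum ha hsa hL hbd h0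
  · exact ⟨g, fun v A hA => by rw [hg, exitTangent_apply _ _ _ _ hA, if_pos rfl], hLg⟩

/-! ### Exchanges -/

omit ha hsa hL in
open Classical in
theorem exchangeTangent_apply (u w v : V) {A : Set (Queue K V)} (hA : MeasurableSet A) :
    (exchangeTangent u w μ).1 v A = if v = w then
      (μ u : Measure (Queue K V)).real A - (μ w : Measure (Queue K V)).real A else 0 := by
  rw [exchangeTangent, tangentSingle_apply, _root_.sub_apply,
    Measure.toSignedMeasure_apply_measurable hA, Measure.toSignedMeasure_apply_measurable hA]

theorem exists_exchange_sum :
    ∃ g : tangentSpace K V, (∀ v A, MeasurableSet A → g.1 v A = net.termE μ v A) ∧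
      HasSum (net.exchangeTerm L μ) (L g) := by
  classical
  obtain ⟨b, hb⟩ := net.exchangeRate_bounded
  obtain ⟨d, hd⟩ := net.exists_card_nbrs_le
  let h : V → tangentSpace K V := fun v =>
    ∑ u ∈ net.nbrs v, net.exchangeRate u v • exchangeTangent u v μ
  have hval : ∀ w v A, (h w).1 v A =
      ∑ u ∈ net.nbrs w, net.exchangeRate u w * (exchangeTangent u w μ).1 v A := fun w v A =>
    map_sum (tangentEval v A) _ _
  have hterm : ∀ v A, MeasurableSet A → (h v).1 v A = net.termE μ v A := by
    intro v A hA
    rw [hval, termE]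
    -- The generator carries the rate from `u` to `v` and `termE` the reversed one; symmetry
    -- identifies them.
    exact Finset.sum_congr rfl fun u hu => by
      rw [exchangeTangent_apply _ _ _ _ hA, if_pos rfl,
        net.exchangeRate_symm u v (net.mem_nbrs.1 hu).symm]
  have hbd : ∀ v A, |(h v).1 v A| ≤ d * |b| := by
    intro v A
    by_cases hA : MeasurableSet A
    · rw [hterm v A hA, termE]
      refine (Finset.abs_sum_le_sum_abs _ _).trans ?_
      refine (Finset.sum_le_card_nsmul _ _ |b| fun u hu => ?_).trans ?_
      · rw [abs_mul]
        have h1 := real_mem_Icc (μ u) A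
        have h2 := real_mem_Icc (μ v) A
        refine (mul_le_mul ((hb v u (net.mem_nbrs.1 hu)).le.trans (le_abs_self b))
          (abs_sub_le_of_le_of_le h1.1 h1.2 h2.1 h2.2) (abs_nonneg _) (abs_nonneg b)).trans_eq ?_
        simp
      · rw [nsmul_eq_mul]
        have := hd v
        gcongr
    · rw [VectorMeasure.not_measurable _ hA, abs_zero]
      positivity
  have h0 : ∀ w v, v ≠ w → ∀ A, (h w).1 v A = 0 := by
    intro w v hne A
    rw [hval]
    refine Finset.sum_eq_zero fun u _ => ?_
    rw [exchangeTangent, tangentSingle_apply, if_neg hne, mul_zero]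
  obtain ⟨g, hg, hLg⟩ := exists_diagonal_sum ha hsa hL hbd h0
  · refine ⟨g, fun v A hA => by rw [hg, hterm v A hA], hLg.congr_fun fun v => ?_⟩
    simp only [exchangeTerm, h, map_sum, map_smul, smul_eq_mul]

/-! ### Jumps -/

omit ha hsa hL in
open Classical in
theorem jumpTangent_apply [Countable K] (w u v : V) (A : Set (Queue K V)) :
    (net.jumpTangent w u μ).1 v A =
      (if v = w then (net.jumpFlux w u μ).map Prod.fst A else 0) +
        if v = u then (net.jumpFlux w u μ).map Prod.snd A else 0 := by
  rw [← tangentSingle_apply w _ (by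
      rw [VectorMeasure.map_apply _ measurable_fst .univ, preimage_univ]
      simp [jumpFlux, VectorMeasure.map_apply _ (net.measurable_zeta w u)]),
    ← tangentSingle_apply u _ (by
      rw [VectorMeasure.map_apply _ measurable_snd .univ, preimage_univ]
      simp [jumpFlux, VectorMeasure.map_apply _ (net.measurable_zeta w u)])]
  rfl

theorem exists_jump_sum [Countable K] :
    ∃ g : tangentSpace K V, (∀ v A, g.1 v A =
        ∑ u ∈ net.nbrs v, (net.jumpFlux v u μ).map Prod.fst A +
          ∑ u ∈ net.nbrs v, (net.jumpFlux u v μ).map Prod.snd A) ∧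
      HasSum (net.jumpTerm L μ) (L g) := by
  classical
  obtain ⟨B, hB0, hB⟩ := net.exists_serviceRate_le
  obtain ⟨d, hd⟩ := net.exists_card_nbrs_le
  let h : V → tangentSpace K V := fun w => ∑ u ∈ net.nbrs w, net.jumpTangent w u μ
  -- Regrouping by the node affected: the jumps out of `w` change the component `v` as source if `w
  -- = v`, and as target if `w` is a neighbour of `v`.
  have hval : ∀ w v A, (h w).1 v A =
      (if w = v then ∑ u ∈ net.nbrs v, (net.jumpFlux v u μ).map Prod.fst A else 0) +
        if w ∈ net.nbrs v then (net.jumpFlux w v μ).map Prod.snd A else 0 := by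
    intro w v A
    have h1 : (h w).1 v A = ∑ u ∈ net.nbrs w, (net.jumpTangent w u μ).1 v A :=
      map_sum (tangentEval v A) _ _
    rw [h1, Finset.sum_congr rfl fun u _ => net.jumpTangent_apply μ w u v A,
      Finset.sum_add_distrib, Finset.sum_ite_eq]
    congr 1
    · split_ifs with h1 h2 h2
      · rw [h1]
      · exact absurd h1.symm h2
      · exact absurd h2.symm h1
      · exact Finset.sum_const_zero
    · simp only [net.mem_nbrs_comm (v := w)]
  have hsum : ∀ v (x : ℝ) (y : V → ℝ), HasSum (fun w => (if w = v then x else 0) +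
      if w ∈ net.nbrs v then y w else 0) (x + ∑ u ∈ net.nbrs v, y u) := by
    intro v x y
    refine (hasSum_ite_eq v x).add ?_
    rw [← Finset.sum_congr rfl fun u hu => if_pos (t := y u) (e := 0) hu]
    exact hasSum_sum_of_ne_finset_zero fun w hw => if_neg hw
  have hmarg : ∀ (f : Queue K V × Queue K V → Queue K V), Measurable f → ∀ w u A,
      |(net.jumpFlux w u μ).map f A| ≤ B := by
    intro f hf w u A
    by_cases hA : MeasurableSet A
    · rw [VectorMeasure.map_apply _ hf hA]
      exact net.abs_jumpFlux_le hB w u μ _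
    · rwa [VectorMeasure.not_measurable _ hA, abs_zero]
  have hbd : ∀ w v A, |(h w).1 v A| ≤
      (if w = v then d * B else 0) + if w ∈ net.nbrs v then B else 0 := by
    intro w v A
    rw [hval]
    refine (abs_add_le _ _).trans (add_le_add ?_ ?_)
    · split_ifs
      · refine (Finset.abs_sum_le_sum_abs _ _).trans ?_
        refine (Finset.sum_le_card_nsmul _ _ B fun u _ => hmarg _ measurable_fst v u A).trans ?_
        rw [nsmul_eq_mul]
        have := hd v
        gcongr
      · rw [abs_zero]
    · split_ifs
      · exact hmarg _ measurable_snd w v A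
      · rw [abs_zero]
  -- At one node there are at most `d` outgoing and at most `d` incoming fluxes, each bounded by
  -- `B`.
  have htot : ∀ v, ∑' w, ((if w = v then d * B else 0) + if w ∈ net.nbrs v then B else 0) ≤
      d * B + d * B := by
    intro v
    rw [(hsum v (d * B) fun _ => B).tsum_eq, Finset.sum_const, nsmul_eq_mul]
    have := hd v
    gcongr
  obtain ⟨g, hg, hLg⟩ := exists_tangent_hasSum h hbd
    (fun v => (hsum v (d * B) fun _ => B).summable) htot ha hsa hL
  · refine ⟨g, fun v A => (hg v A).unique ?_, hLg.congr_fun fun v => ?_⟩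
    · simp only [hval]
      exact hsum v _ _
    · simp only [jumpTerm, h, map_sum]

/-! ### The jump part of the evolution equation -/

omit ha hsa hL in
-- Both sides are integrals of an intensity times an increment of the indicator of `A`; the
-- integrands agree pointwise by `jump_add_exit`.
theorem sum_departures_add_exit (v : V) {A : Set (Queue K V)} (hA : MeasurableSet A) :
    ∑ u ∈ net.nbrs v,
        (∫ q in net.depart v ⁻¹' A, net.jumpRate v u q ∂(μ v : Measure (Queue K V)) -
          ∫ q in A, net.jumpRate v u q ∂(μ v : Measure (Queue K V))) +
      (∫ q in net.psiNN v ⁻¹' A, net.serviceRate v q ∂(μ v : Measure (Queue K V)) -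
        ∫ q in A, net.serviceRate v q ∂(μ v : Measure (Queue K V))) = net.termD μ v A := by
  have key : ∀ (ρ : Queue K V → ℝ) (φ : Queue K V → Queue K V),
      Integrable ρ (μ v : Measure (Queue K V)) → Measurable φ →
      Integrable (fun q => ρ q * (A.indicator 1 (φ q) - A.indicator 1 q))
          (μ v : Measure (Queue K V)) ∧
        ∫ q in φ ⁻¹' A, ρ q ∂(μ v : Measure (Queue K V)) -
            ∫ q in A, ρ q ∂(μ v : Measure (Queue K V)) =
          ∫ q, ρ q * (A.indicator 1 (φ q) - A.indicator 1 q) ∂(μ v : Measure (Queue K V)) := by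
    intro ρ φ hρ hφ
    have h1 : (fun q => ρ q * (A.indicator 1 (φ q) - A.indicator 1 q)) =
        fun q => (φ ⁻¹' A).indicator ρ q - A.indicator ρ q := by
      classical
      funext q
      simp only [indicator_apply, mem_preimage, Pi.one_apply]
      split_ifs <;> simp
    have hi1 := hρ.indicator (hφ hA)
    have hi2 := hρ.indicator hA
    rw [h1]
    refine ⟨hi1.sub hi2, ?_⟩
    rw [integral_sub hi1 hi2, integral_indicator (hφ hA), integral_indicator hA]
  have hj := fun u => key _ _ (net.integrable_jumpRate v u (μ v)) (net.measurable_depart v)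
  have he := key _ _ (net.integrable_serviceRate v (μ v)) (net.measurable_psiNN v)
  have hD := key _ _ (net.integrable_serviceRate v (μ v)) (net.measurable_depart v)
  rw [termD, hD.2, he.2, Finset.sum_congr rfl fun u _ => (hj u).2,
    ← integral_finsetSum _ fun u _ => (hj u).1,
    ← integral_add (integrable_finsetSum _ fun u _ => (hj u).1) he.1]
  exact integral_congr_ae (Eventually.of_forall fun q => net.jump_add_exit v q (A.indicator 1))

omit ha hsa hL in
theorem summable_totalArrivalRate [Countable K] (v : V) :
    Summable (net.totalArrivalRate μ v) :=
  (summable_sum fun u _ => (net.hasSum_integral_transitDensity u v μ).summable).add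
    (net.lam_summable v)

omit ha hsa hL in
theorem totalArrivalRate_nonneg (v : V) (c : K × V) : 0 ≤ net.totalArrivalRate μ v c :=
  add_nonneg (Finset.sum_nonneg fun u _ => net.integral_transitDensity_nonneg u v c _)
    (net.lam_nonneg _ _ _)

omit ha hsa hL in
theorem hasSum_termB_add_termC [Countable K] (v : V) (A : Set (Queue K V)) :
    HasSum (fun c => net.totalArrivalRate μ v c *
        ((μ v : Measure (Queue K V)).real (Queue.arrive c ⁻¹' A) -
          (μ v : Measure (Queue K V)).real A))
      (net.termB μ v A + net.termC μ v A) := by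
  have hs := net.summable_totalArrivalRate μ v
  have h1 : Summable fun c => net.totalArrivalRate μ v c *
      (μ v : Measure (Queue K V)).real (Queue.arrive c ⁻¹' A) :=
    hs.of_nonneg_of_le (fun c => mul_nonneg (net.totalArrivalRate_nonneg μ v c) measureReal_nonneg)
      fun c => mul_le_of_le_one_right (net.totalArrivalRate_nonneg μ v c) (real_mem_Icc _ _).2
  simp only [mul_sub]
  rw [termC, ← sub_eq_add_neg, mul_comm]
  exact h1.hasSum.sub (hs.hasSum.mul_right _)

/-- The four series of the limiting generator converge, to the value of the differential at the
jump part of the evolution equation. -/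
theorem exists_jumpPart [Countable K] :
    ∃ g : tangentSpace K V, net.IsJumpPart μ g ∧
      ∃ x₁ x₂ x₃ x₄, HasSum (net.jumpTerm L μ) x₁ ∧ HasSum (net.arrivalTerm L μ) x₂ ∧
        HasSum (net.exitTerm L μ) x₃ ∧ HasSum (net.exchangeTerm L μ) x₄ ∧
        L g = x₁ + x₂ + x₃ + x₄ := by
  obtain ⟨g₁, h₁, hL₁⟩ := net.exists_jump_sum ha hsa hL μ
  obtain ⟨g₂, h₂, hL₂⟩ := net.exists_arrival_sum ha hsa hL μ
  obtain ⟨g₃, h₃, hL₃⟩ := net.exists_exit_sum ha hsa hL μ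
  obtain ⟨g₄, h₄, hL₄⟩ := net.exists_exchange_sum ha hsa hL μ
  refine ⟨g₁ + g₂ + g₃ + g₄, fun v A hA => ?_, _, _, _, _, hL₁, hL₂, hL₃, hL₄,
    by simp only [map_add]⟩
  change g₁.1 v A + g₂.1 v A + g₃.1 v A + g₄.1 v A = _
  -- The total arrival rate is transit plus external, so both sides are sums of the same series over
  -- labels.
  have hBC : net.termB μ v A + net.termC μ v A =
      ∑ u ∈ net.nbrs v, (net.jumpFlux u v μ).map Prod.snd A + g₂.1 v A := by
    refine (net.hasSum_termB_add_termC μ v A).unique ?_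
    refine ((hasSum_sum fun u _ => net.jumpFlux_snd u v μ hA).add (h₂ v A hA)).congr_fun fun c => ?_
    rw [totalArrivalRate, transitRate_eq, add_mul, Finset.sum_mul]
  rw [hBC, ← net.sum_departures_add_exit μ v hA, h₁, h₃ v A hA, h₄ v A hA,
    Finset.sum_congr rfl fun u _ => net.jumpFlux_fst v u μ hA]
  ring

end Functional

end JumpingNetwork

/-! ### Geometry of the closed orthants. -/

theorem convex_orthant (n : ℕ) : Convex ℝ (orthant n) := by
  intro x hx y hy s t hs ht _ i
  exact add_nonneg (mul_nonneg hs (hx i)) (mul_nonneg ht (hy i))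

/-- A convex set with nonempty interior has unique derivatives, so `fderivWithin` of a shifted
function can be read off from the chain rule. -/
theorem uniqueDiffOn_orthant (n : ℕ) : UniqueDiffOn ℝ (orthant n) := by
  refine uniqueDiffOn_convex (convex_orthant n) ⟨WithLp.toLp 2 fun _ => 1, ?_⟩
  have hopen : IsOpen {x : EuclideanSpace ℝ (Fin n) | ∀ i, 0 < x i} := by
    simp only [ofPred_forall]
    exact isOpen_iInter_of_finite fun i => isOpen_lt continuous_const (by fun_prop)
  exact interior_maximal (fun x hx i => (hx i).le) hopen (fun _ => one_pos)

namespace JumpingNetwork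

variable {K V : Type*} (net : JumpingNetwork K V)

/-! ### The motion along the field `r` in the orthants -/

/-- Service does not change the word, so the same customer stays in service and the shifts form a
semigroup. -/
theorem shift_shift (v : V) (s t : ℝ≥0) (q : Queue K V) :
    net.shift v s (net.shift v t q) = net.shift v (t + s) q := by
  have hidx : net.servedIdx v (net.shift v t q) = net.servedIdx v q := rfl
  obtain ⟨w, x⟩ := q
  unfold shift at hidx ⊢
  rw [hidx]
  simp only [Queue.serve]
  congr 1
  funext j
  split_ifs
  · rw [add_assoc]
  · rfl

theorem shift_zero (v : V) (q : Queue K V) : net.shift v 0 q = q := by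
  obtain ⟨w, x⟩ := q
  simp [shift, Queue.serve]

/-- The field `r` on the orthant of the word `w`, for queues at `v`. -/
def direction (v : V) (w : List (K × V)) : EuclideanSpace ℝ (Fin w.length) :=
  if h : net.servedIdx v (⟨w, 0⟩ : Queue K V) < w.length then EuclideanSpace.single ⟨_, h⟩ 1 else 0

theorem norm_direction_le (v : V) (w : List (K × V)) : ‖net.direction v w‖ ≤ 1 := by
  unfold direction
  split_ifs <;> simp

theorem direction_apply (v : V) (w : List (K × V)) (j : Fin w.length) :
    net.direction v w j = if (j : ℕ) = net.servedIdx v (⟨w, 0⟩ : Queue K V) then 1 else 0 := by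
  unfold direction
  split_ifs with h1 h2 h2
  · simp [← h2]
  · simp [Fin.ext_iff, h2]
  · exact absurd (h2 ▸ j.2) h1
  · simp

theorem add_smul_direction_mem (v : V) {w : List (K × V)} {x : EuclideanSpace ℝ (Fin w.length)}
    (hx : x ∈ orthant w.length) {t : ℝ} (ht : 0 ≤ t) :
    x + t • net.direction v w ∈ orthant w.length := by
  intro j
  have h : 0 ≤ net.direction v w j := by
    rw [direction_apply]
    split_ifs <;> norm_num
  exact add_nonneg (hx j) (mul_nonneg ht h)

/-- In an orthant the motion is a translation. The point must lie in the orthant because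
`Real.toNNReal` is additive only on nonnegative numbers. -/
theorem onOrthant_add_smul_direction (f : Queue K V → ℝ) (v : V) {w : List (K × V)}
    {x : EuclideanSpace ℝ (Fin w.length)} (hx : x ∈ orthant w.length) (t : ℝ≥0) :
    onOrthant f w (x + (t : ℝ) • net.direction v w) = onOrthant (f ∘ net.shift v t) w x := by
  simp only [onOrthant, Function.comp_apply, shift, Queue.serve]
  congr 2
  funext j
  have hidx : net.servedIdx v (⟨w, fun i => (x i).toNNReal⟩ : Queue K V) =
    net.servedIdx v (⟨w, 0⟩ : Queue K V) := rfl
  rw [hidx, PiLp.add_apply, PiLp.smul_apply, direction_apply]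
  split_ifs with h
  · simp [Real.toNNReal_add (hx j) t.coe_nonneg]
  · simp

theorem apply_shift (f : Queue K V → ℝ) (v : V) (q : Queue K V) {t : ℝ} (ht : 0 ≤ t) :
    f (net.shift v t.toNNReal q) =
      onOrthant f q.1 (orthantPoint q.2 + t • net.direction v q.1) := by
  have h := net.onOrthant_add_smul_direction f v (orthantPoint_mem q.2) t.toNNReal
  rw [Real.coe_toNNReal t ht] at h
  rw [h, onOrthant_orthantPoint]
  rfl

end JumpingNetwork

/-! ### Test functions along the motion. -/

namespace IsC1

variable {K V : Type*} (net : JumpingNetwork K V) {f : Queue K V → ℝ} {b d : ℝ}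

/-- A translation mapping the orthant into itself has the identity as derivative, so neither bound
changes. This is what allows the transport equation to be tested on shifted functions. -/
theorem comp_shift (hf : IsC1 f b d) (v : V) (t : ℝ≥0) : IsC1 (f ∘ net.shift v t) b d := by
  have hmaps : ∀ w : List (K × V), MapsTo (fun x => x + (t : ℝ) • net.direction v w)
      (orthant w.length) (orthant w.length) := fun w x hx => net.add_smul_direction_mem v hx t.coe_nonneg
  have heq : ∀ w : List (K × V), EqOn (onOrthant (f ∘ net.shift v t) w)
      (onOrthant f w ∘ fun x => x + (t : ℝ) • net.direction v w) (orthant w.length) :=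
    fun w x hx => (net.onOrthant_add_smul_direction f v hx t).symm
  refine ⟨fun w => ?_, fun q => hf.bound _, fun w x hx => ?_⟩
  · exact ((hf.contDiffOn w).comp (contDiff_id.add contDiff_const).contDiffOn (hmaps w)).congr
      (heq w)
  · have h1 := ((hf.contDiffOn w).differentiableOn one_ne_zero _ (hmaps w hx)).hasFDerivWithinAt
    have h2 := (h1.comp x ((hasFDerivWithinAt_id x _).add_const _) (hmaps w)).congr (heq w)
      (heq w hx)
    rw [h2.fderivWithin (uniqueDiffOn_orthant _ x hx), ContinuousLinearMap.comp_id]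
    exact hf.deriv_bound w _ (hmaps w hx)

/-- Mean value inequality on the convex orthant, along a field of length at most one. -/
theorem abs_shift_sub_le (hf : IsC1 f b d) (v : V) (t : ℝ≥0) (q : Queue K V) :
    |f (net.shift v t q) - f q| ≤ d * t := by
  have h := (convex_orthant _).norm_image_sub_le_of_norm_fderivWithin_le
    ((hf.contDiffOn q.1).differentiableOn one_ne_zero) (hf.deriv_bound q.1)
    (orthantPoint_mem q.2) (net.add_smul_direction_mem v (orthantPoint_mem q.2) t.coe_nonneg)
  have h1 := net.apply_shift f v q t.coe_nonneg
  rw [Real.toNNReal_coe] at h1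
  rw [← h1, onOrthant_orthantPoint, add_sub_cancel_left, norm_smul,
    Real.norm_of_nonneg t.coe_nonneg] at h
  refine h.trans (mul_le_mul_of_nonneg_left ?_ hf.deriv_bound_nonneg)
  exact mul_le_of_le_one_right t.coe_nonneg (net.norm_direction_le v q.1)

theorem continuousOn_shift (hf : IsC1 f b d) (v : V) (q : Queue K V) :
    ContinuousOn (fun t : ℝ => f (net.shift v t.toNNReal q)) (Ici 0) := by
  refine ContinuousOn.congr ?_ fun t ht => net.apply_shift f v q ht
  exact (hf.contDiffOn q.1).continuousOn.comp (by fun_prop)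
    fun t ht => net.add_smul_direction_mem v (orthantPoint_mem q.2) ht

theorem hasDerivWithinAt_shift (hf : IsC1 f b d) (v : V) (q : Queue K V) :
    HasDerivWithinAt (fun t : ℝ => f (net.shift v t.toNNReal q)) (net.alongField v f q)
      (Ici 0) 0 := by
  refine DifferentiableWithinAt.hasDerivWithinAt ?_
  have hmaps : MapsTo (fun t : ℝ => orthantPoint q.2 + t • net.direction v q.1) (Ici 0)
      (orthant q.1.length) := fun t ht => net.add_smul_direction_mem v (orthantPoint_mem q.2) ht
  have h := ((hf.contDiffOn q.1).differentiableOn one_ne_zero _ (hmaps self_mem_Ici)).comp (0 : ℝ)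
    (by fun_prop : DifferentiableWithinAt ℝ
      (fun t : ℝ => orthantPoint q.2 + t • net.direction v q.1) (Ici 0) 0) hmaps
  exact h.congr (fun t ht => net.apply_shift f v q ht) (net.apply_shift f v q le_rfl)

theorem integrable (hf : IsC1 f b d) (m : Measure (Queue K V)) [IsFiniteMeasure m] :
    Integrable f m :=
  integrable_of_bounded hf.measurable hf.bound

theorem integrable_shift (hf : IsC1 f b d) (v : V) (t : ℝ≥0) (m : Measure (Queue K V))
    [IsFiniteMeasure m] : Integrable (fun q => f (net.shift v t q)) m :=
  (hf.comp_shift net v t).integrable m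

/-- Dominated convergence of the difference quotients, which are bounded by `d`. -/
theorem hasDerivWithinAt_integral_shift_zero (hf : IsC1 f b d) (v : V) (m : Measure (Queue K V))
    [IsFiniteMeasure m] :
    HasDerivWithinAt (fun t : ℝ => ∫ q, f (net.shift v t.toNNReal q) ∂m)
      (∫ q, net.alongField v f q ∂m) (Ici 0) 0 := by
  rw [hasDerivWithinAt_iff_tendsto_slope, Ici_sdiff_left]
  have hslope : ∀ t : ℝ, slope (fun t : ℝ => ∫ q, f (net.shift v t.toNNReal q) ∂m) 0 t =
      ∫ q, slope (fun t : ℝ => f (net.shift v t.toNNReal q)) 0 t ∂m := by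
    intro t
    simp only [slope_def_module, smul_eq_mul]
    rw [integral_const_mul, integral_sub (hf.integrable_shift net v _ m)
      (hf.integrable_shift net v _ m)]
  simp only [funext hslope]
  refine tendsto_integral_filter_of_dominated_convergence (fun _ => d)
    (Eventually.of_forall fun t => ?_) ?_ (integrable_const d) (Eventually.of_forall fun q => ?_)
  · simp only [slope_def_module, smul_eq_mul]
    exact (((hf.comp_shift net v _).measurable.sub
      (hf.comp_shift net v _).measurable).const_mul _).aestronglyMeasurable
  · filter_upwards [self_mem_nhdsWithin] with t ht
    refine Eventually.of_forall fun q => ?_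
    have ht' : (0 : ℝ) < t := ht
    have h := hf.abs_shift_sub_le net v t.toNNReal q
    rw [Real.coe_toNNReal t ht'.le] at h
    rw [slope_def_field, Real.toNNReal_zero, net.shift_zero, sub_zero, norm_div, Real.norm_eq_abs,
      Real.norm_of_nonneg ht'.le, div_le_iff₀ ht']
    exact h
  · have h := hf.hasDerivWithinAt_shift net v q
    rwa [hasDerivWithinAt_iff_tendsto_slope, Ici_sdiff_left] at h

/-- By the semigroup property, the right derivative at `s` for `f` is the one at zero for `f`
shifted by `s`. -/
theorem hasDerivWithinAt_integral_shift (hf : IsC1 f b d) (v : V) (m : Measure (Queue K V))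
    [IsFiniteMeasure m] {s : ℝ} (hs : 0 ≤ s) :
    HasDerivWithinAt (fun t : ℝ => ∫ q, f (net.shift v t.toNNReal q) ∂m)
      (∫ q, net.alongField v (f ∘ net.shift v s.toNNReal) q ∂m) (Ici s) s := by
  have h := (hf.comp_shift net v s.toNNReal).hasDerivWithinAt_integral_shift_zero net v m
  have h2 := h.scomp_of_eq s (((hasDerivAt_id s).sub_const s).hasDerivWithinAt (s := Ici s))
    (fun t ht => mem_Ici.2 (sub_nonneg.2 ht)) (sub_self s).symm
  rw [one_smul] at h2
  have key : ∀ t ∈ Ici s, ∫ q, f (net.shift v t.toNNReal q) ∂m =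
      ∫ q, (f ∘ net.shift v s.toNNReal) (net.shift v (t - s).toNNReal q) ∂m := by
    intro t ht
    simp only [Function.comp_apply, net.shift_shift]
    rw [← Real.toNNReal_add (sub_nonneg.2 ht) hs, sub_add_cancel]
  exact h2.congr key (key s self_mem_Ici)

theorem continuousOn_integral_shift (hf : IsC1 f b d) (v : V) (m : Measure (Queue K V))
    [IsFiniteMeasure m] :
    ContinuousOn (fun t : ℝ => ∫ q, f (net.shift v t.toNNReal q) ∂m) (Ici 0) :=
  continuousOn_of_dominated
    (fun _ _ => (hf.comp_shift net v _).measurable.aestronglyMeasurable)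
    (fun _ _ => Eventually.of_forall fun _ => hf.bound _) (integrable_const b)
    (Eventually.of_forall fun q => hf.continuousOn_shift net v q)

end IsC1

/-! ### The time shift to first order. -/

namespace JumpingNetwork

variable {K V : Type*} (net : JumpingNetwork K V)

/-- The time shift is approximated to the second order by the transport term. -/
theorem abs_integral_shift_sub_le {μ : NetState K V} {𝒶 : tangentSpace K V}
    (h𝒶 : net.IsTransportPart μ 𝒶) {C : ℝ} (hC : ∀ v A, |𝒶.1 v A| ≤ C) {f : Queue K V → ℝ}
    {b d : ℝ} (hf : IsC1 f b d) (v : V) {t : ℝ} (ht : 0 ≤ t) :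
    |∫ q, f (net.shift v t.toNNReal q) ∂(μ v : Measure (Queue K V)) -
        ∫ q, f q ∂(μ v : Measure (Queue K V)) - t * ∫ᵛ q, f q ∂<•(𝒶.1 v)| ≤
      d * t * (2 * C) * t := by
  have hder : ∀ s ∈ Ico 0 t, HasDerivWithinAt
      (fun s : ℝ => ∫ q, f (net.shift v s.toNNReal q) ∂(μ v : Measure (Queue K V)) -
        s * ∫ᵛ q, f q ∂<•(𝒶.1 v))
      (∫ᵛ q, (f ∘ net.shift v s.toNNReal) q ∂<•(𝒶.1 v) - 1 * ∫ᵛ q, f q ∂<•(𝒶.1 v))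
      (Ici s) s := by
    intro s hs
    -- The transport equation, tested on the shifted function, turns the derivative at time `s` into
    -- an integral against `𝒶`.
    rw [h𝒶 v _ b d (hf.comp_shift net v s.toNNReal)]
    exact (hf.hasDerivWithinAt_integral_shift net v _ hs.1).sub
      ((hasDerivAt_id s).hasDerivWithinAt.mul_const _)
  have hbound : ∀ s ∈ Ico 0 t,
      ‖∫ᵛ q, (f ∘ net.shift v s.toNNReal) q ∂<•(𝒶.1 v) - 1 * ∫ᵛ q, f q ∂<•(𝒶.1 v)‖ ≤
        d * t * (2 * C) := by
    intro s hs
    have hm := (hf.comp_shift net v s.toNNReal)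
    rw [one_mul, ← VectorMeasure.integral_fun_sub (hm.integrable _) (hf.integrable _)]
    -- The shifted function is close to `f` only uniformly, with error `d * t`; its derivative need
    -- not be close. This is why `𝒶` has to be a bounded measure and not merely a functional on
    -- `𝒞₁`.
    refine abs_integral_signedMeasure_le _ (hC v) (hm.measurable.sub hf.measurable) (fun q => ?_)
      (mul_nonneg hf.deriv_bound_nonneg ht)
    refine (hf.abs_shift_sub_le net v s.toNNReal q).trans
      (mul_le_mul_of_nonneg_left ?_ hf.deriv_bound_nonneg)
    rw [Real.coe_toNNReal s hs.1]
    exact hs.2.le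
  have hcont : ContinuousOn
      (fun s : ℝ => ∫ q, f (net.shift v s.toNNReal q) ∂(μ v : Measure (Queue K V)) -
        s * ∫ᵛ q, f q ∂<•(𝒶.1 v)) (Icc 0 t) :=
    ((hf.continuousOn_integral_shift net v _).mono Icc_subset_Ici_self).sub (by fun_prop)
  have h := norm_image_sub_le_of_norm_deriv_right_le_segment hcont hder hbound t
    (right_mem_Icc.2 ht)
  simp only [Real.toNNReal_zero, net.shift_zero, zero_mul, sub_zero] at h
  rwa [sub_right_comm] at h

theorem integral_stateDiff (f : Queue K V → ℝ) {b d : ℝ} (hf : IsC1 f b d) (μ : NetState K V)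
    (v : V) (t : ℝ≥0) :
    ∫ᵛ q, f q ∂<•((stateDiff (net.shiftState t μ) μ).1 v) =
      ∫ q, f (net.shift v t q) ∂(μ v : Measure (Queue K V)) -
        ∫ q, f q ∂(μ v : Measure (Queue K V)) := by
  change ∫ᵛ q, f q ∂<•((net.shiftState t μ v : Measure (Queue K V)).toSignedMeasure -
      (μ v : Measure (Queue K V)).toSignedMeasure) = _
  rw [VectorMeasure.integral_sub_vectorMeasure (hf.integrable _) (hf.integrable _),
    VectorMeasure.integral_toSignedMeasure, VectorMeasure.integral_toSignedMeasure]
  congr 1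
  rw [shiftState, ProbabilityMeasure.toMeasure_map,
    integral_map (net.measurable_shift v t).aemeasurable hf.measurable.aestronglyMeasurable]

theorem norm1_shift_sub_le (μ : NetState K V) (v : V) (t : ℝ≥0) :
    norm1 ((stateDiff (net.shiftState t μ) μ).1 v) ≤ t := by
  refine norm1_le t.coe_nonneg fun f b d hf hbd => ?_
  rw [net.integral_stateDiff f hf,
    ← integral_sub (hf.integrable_shift net v t _) (hf.integrable _)]
  have h := norm_integral_le_of_norm_le_const (μ := (μ v : Measure (Queue K V)))
    (f := fun q => f (net.shift v t q) - f q) (C := d * t)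
    (Eventually.of_forall fun q => hf.abs_shift_sub_le net v t q)
  rw [probReal_univ, mul_one] at h
  refine h.trans (mul_le_of_le_one_left t.coe_nonneg ?_)
  linarith [hf.bound_nonneg]

theorem norm1_shift_sub_smul_le {μ : NetState K V} {𝒶 : tangentSpace K V}
    (h𝒶 : net.IsTransportPart μ 𝒶) {C : ℝ} (hC : ∀ v A, |𝒶.1 v A| ≤ C) (v : V) (t : ℝ≥0) :
    norm1 ((stateDiff (net.shiftState t μ) μ - (t : ℝ) • 𝒶 : tangentSpace K V).1 v) ≤
      2 * C * (t * t) := by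
  have hC0 : 0 ≤ C := (abs_nonneg _).trans (hC v univ)
  refine norm1_le (by positivity) fun f b d hf hbd => ?_
  change |∫ᵛ q, f q ∂<•((stateDiff (net.shiftState t μ) μ).1 v - (t : ℝ) • 𝒶.1 v)| ≤ _
  rw [VectorMeasure.integral_sub_vectorMeasure (hf.integrable _) (hf.integrable _),
    VectorMeasure.integral_smul_vectorMeasure, net.integral_stateDiff f hf, smul_eq_mul]
  have h := net.abs_integral_shift_sub_le h𝒶 hC hf v t.coe_nonneg
  rw [Real.toNNReal_coe] at h
  refine h.trans ?_
  have hd : d ≤ 1 := by linarith [hf.bound_nonneg]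
  calc d * t * (2 * C) * t = d * (2 * C * (t * t)) := by ring
    _ ≤ _ := mul_le_of_le_one_left (by positivity) hd

theorem shiftState_zero (μ : NetState K V) : net.shiftState 0 μ = μ := by
  funext v
  refine Subtype.ext ?_
  change Measure.map (net.shift v 0) (μ v : Measure (Queue K V)) = _
  rw [show net.shift v 0 = id from funext (net.shift_zero v), Measure.map_id]
  rfl

/-- The derivative of a differentiable function of the state along the time shift is the value of
its differential at the transport term. -/
theorem hasDerivWithinAt_shiftState {a : V → ℝ} {F : NetState K V → ℝ} {μ : NetState K V}
    {L : tangentSpace K V →ₗ[ℝ] ℝ} (hF : HasFrechetDifferentialAt a F μ L)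
    {𝒶 : tangentSpace K V} (h𝒶 : net.IsTransportPart μ 𝒶) :
    HasDerivWithinAt (fun t : ℝ => F (net.shiftState t.toNNReal μ)) (L 𝒶) (Ici 0) 0 := by
  obtain ⟨C, hC⟩ := 𝒶.2.2
  obtain ⟨C', hL⟩ := hF.continuous
  set W := ∑' v, a v with hW
  have hW0 : 0 ≤ W := tsum_nonneg hF.nonneg
  -- `Q` is the constant of the quadratic remainder of `L`. Below, half of `ε` goes to this
  -- remainder and half to the Fréchet error; adding one to `W` and `Q` avoids division by zero.
  set Q := |C'| * (W * (2 * |C|)) with hQ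
  have hQ0 : 0 ≤ Q := by positivity
  rw [hasDerivWithinAt_iff_isLittleO, Asymptotics.isLittleO_iff]
  intro ε hε
  obtain ⟨δ, hδ, hFδ⟩ := hF.isLittleO (ε / (2 * (W + 1))) (by positivity)
  have hρ : 0 < min (δ / (W + 1)) (ε / (2 * (Q + 1))) := by positivity
  filter_upwards [self_mem_nhdsWithin, nhdsWithin_le_nhds (Iio_mem_nhds hρ)] with t ht0 htρ
  have ht0 : 0 ≤ t := ht0
  have ht1 : t < δ / (W + 1) := lt_of_lt_of_le htρ (min_le_left _ _)
  have ht2 : t < ε / (2 * (Q + 1)) := lt_of_lt_of_le htρ (min_le_right _ _)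
  set ν := net.shiftState t.toNNReal μ with hν
  have hcoe : (t.toNNReal : ℝ) = t := Real.coe_toNNReal t ht0
  have hdiff : weightedNorm a (stateDiff ν μ) ≤ W * t := by
    refine weightedNorm_le_const hF.nonneg hF.summable fun v => ?_
    simpa only [hcoe] using net.norm1_shift_sub_le μ v t.toNNReal
  have hrem : |L (stateDiff ν μ) - t * L 𝒶| ≤ Q * (t * t) := by
    have h1 : L (stateDiff ν μ) - t * L 𝒶 = L (stateDiff ν μ - t • 𝒶) := by
      have h := L.map_sub (stateDiff ν μ) (t • 𝒶)
      rw [L.map_smul, smul_eq_mul] at h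
      exact h.symm
    have h2 : weightedNorm a (stateDiff ν μ - t • 𝒶) ≤ W * (2 * |C| * (t * t)) := by
      refine weightedNorm_le_const hF.nonneg hF.summable fun v => ?_
      have := net.norm1_shift_sub_smul_le h𝒶 (fun v A => (hC v A).trans (le_abs_self C)) v
        t.toNNReal
      simpa only [hcoe] using this
    rw [h1]
    calc _ ≤ C' * weightedNorm a (stateDiff ν μ - t • 𝒶) := hL _
      _ ≤ |C'| * (W * (2 * |C| * (t * t))) :=
          mul_le_mul (le_abs_self C') h2 (weightedNorm_nonneg hF.nonneg _) (abs_nonneg C')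
      _ = Q * (t * t) := by rw [hQ]; ring
  have hδ' : weightedNorm a (stateDiff ν μ) < δ := by
    rw [lt_div_iff₀ (by positivity)] at ht1
    linarith
  have hmain := hFδ ν hδ'
  have e1 : ε / (2 * (W + 1)) * weightedNorm a (stateDiff ν μ) ≤ ε / 2 * t := by
    refine (mul_le_mul_of_nonneg_left hdiff (by positivity)).trans ?_
    rw [div_mul_eq_mul_div, div_mul_eq_mul_div, div_le_div_iff₀ (by positivity) (by positivity)]
    nlinarith [mul_nonneg hε.le ht0]
  have e2 : Q * (t * t) ≤ ε / 2 * t := by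
    rw [lt_div_iff₀ (by positivity)] at ht2
    nlinarith
  rw [Real.toNNReal_zero, net.shiftState_zero, sub_zero, smul_eq_mul, Real.norm_eq_abs,
    Real.norm_of_nonneg ht0]
  calc |F ν - F μ - t * L 𝒶|
      = |(F ν - F μ - L (stateDiff ν μ)) + (L (stateDiff ν μ) - t * L 𝒶)| := by ring_nf
    _ ≤ |F ν - F μ - L (stateDiff ν μ)| + |L (stateDiff ν μ) - t * L 𝒶| := abs_add_le _ _
    _ ≤ ε * t := by linarith

end JumpingNetwork

end

/-! ### Assembly of the two halves. -/

theorem mainTheorem3 {K V : Type*} [Finite K] (net : JumpingNetwork K V)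
    (a : V → ℝ) (F : NetState K V → ℝ) (μ : NetState K V) (L : tangentSpace K V →ₗ[ℝ] ℝ)
    (hF : HasFrechetDifferentialAt a F μ L) :
    (Summable (net.jumpTerm L μ) ∧ Summable (net.arrivalTerm L μ) ∧
      Summable (net.exitTerm L μ) ∧ Summable (net.exchangeTerm L μ)) ∧
    ∃ g : tangentSpace K V, net.IsJumpPart μ g ∧
      net.limitGenerator F L μ = net.timeShiftGenerator F μ + L g ∧
      ∀ A : tangentSpace K V, net.IsTransportPart μ A →
        HasDerivWithinAt (fun t : ℝ => F (net.shiftState t.toNNReal μ)) (L A) (Set.Ici 0) 0 ∧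
        net.limitGenerator F L μ = L (A + g) := by
  obtain ⟨C, hL⟩ := hF.continuous
  obtain ⟨g, hg, x₁, x₂, x₃, x₄, h₁, h₂, h₃, h₄, hLg⟩ :=
    net.exists_jumpPart hF.nonneg hF.summable hL μ
  have hgen : net.limitGenerator F L μ = net.timeShiftGenerator F μ + L g := by
    rw [JumpingNetwork.limitGenerator, h₁.tsum_eq, h₂.tsum_eq, h₃.tsum_eq, h₄.tsum_eq, hLg]
    ring
  -- For real series `Summable` is absolute convergence.
  refine ⟨⟨h₁.summable, h₂.summable, h₃.summable, h₄.summable⟩, g, hg, hgen, fun A hA => ?_⟩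
  have hder := net.hasDerivWithinAt_shiftState hF hA
  refine ⟨hder, ?_⟩
  rw [hgen, map_add, JumpingNetwork.timeShiftGenerator,
    hder.derivWithin (uniqueDiffOn_Ici (0 : ℝ) 0 self_mem_Ici)]
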